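/- Assume Jensen's principle $\diamondsuit$ on $\omega_1$: there is a sequence $\langle A_\alpha : \alpha<\omega_1\rangle$ with $A_\alpha\subseteq\alpha$ such that for every $A\subseteq\omega_1$ the set $\{\alpha<\omega_1 : A\cap\alpha=A_\alpha\}$ is stationary in $\omega_1$. Then there is an Aronszajn compactum $X$ that is both hereditarily separable (every subspace of $X$ is separable) and hereditarily Lindel\"of (every subspace of $X$ is Lindel\"of). Here, an Aronszajn compactum is a compact Hausdorff space $X$ of weight $w(X)=\aleph_1$ and character $\chi(X)=\aleph_0$ that is homeomorphic to some embedded Aronszajn compactum $Z\subseteq[0,1]^{\omega_1}$. A closed subspace $Z\subseteq [0,1]^{\omega_1}$ is an embedded Aronszajn compactum if $w(Z)=\aleph_1$, $\chi(Z)=\aleph_0$, and there is a closed unbounded set $C\subseteq\omega_1$ such that for each $\alpha\in C$ there are only countably many points $x\in Z_\alpha:=\pi_\alpha(Z)$ with $|\{z\in Z:\pi_\alpha(z)=x\}|>1$, where $\pi_\alpha:[0,1]^{\omega_1}\to[0,1]^\alpha$ is the natural projection. -/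

import Mathlib

open Set Topology TopologicalSpace unitInterval
open scoped Cardinal Ordinal

namespace Aronszajn

/-- Jensen's principle `◇` on `ω₁`; here `ω₁` is the set of the ordinals below it. -/
def Diamond : Prop :=
  ∃ A : Iio (ω₁ : Ordinal.{0}) → Set (Iio (ω₁ : Ordinal.{0})), (∀ α, A α ⊆ Iio α) ∧
    ∀ B : Set (Iio (ω₁ : Ordinal.{0})), IsStationary {α | B ∩ Iio α = A α}

universe u

/-- The weight `w(X)`: the least cardinality of a base of `X`, or `ℵ₀` if that is finite. -/
noncomputable def weight (X : Type u) [TopologicalSpace X] : Cardinal.{u} :=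
  max ℵ₀ (sInf {κ | ∃ B : Set (Set X), IsTopologicalBasis B ∧ #B = κ})

/-- `B` is a local base of open sets at the point `x`. -/
def IsLocalBase {X : Type u} [TopologicalSpace X] (x : X) (B : Set (Set X)) : Prop :=
  (∀ V ∈ B, IsOpen V ∧ x ∈ V) ∧ ∀ U : Set X, IsOpen U → x ∈ U → ∃ V ∈ B, V ⊆ U

/-- The character `χ(X)`: the supremum over the points of `X` of the least cardinality of a local
base, or `ℵ₀` if that is finite. -/
noncomputable def character (X : Type u) [TopologicalSpace X] : Cardinal.{u} :=
  max ℵ₀ (⨆ x : X, sInf {κ | ∃ B : Set (Set X), IsLocalBase x B ∧ #B = κ})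

/-- The cube `[0,1]^α`, with the product topology; its coordinates are the ordinals `ξ < α`. -/
abbrev Cube (α : Ordinal.{0}) : Type 1 := Iio α → I

/-- The natural projection `[0,1]^β → [0,1]^α` for `α ≤ β`. -/
def proj {α β : Ordinal.{0}} (h : α ≤ β) (x : Cube β) : Cube α :=
  fun ξ => x ⟨ξ.1, lt_of_lt_of_le ξ.2 h⟩

/-- For `X ⊆ [0,1]^{ω₁}`, the set of those points in the projection `X_α` of `X` to `[0,1]^α` over
which there is more than one point of `X`. -/
def level (X : Set (Cube ω₁)) {α : Ordinal.{0}} (h : α ≤ ω₁) : Set (Cube α) :=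
  {x | x ∈ proj h '' X ∧ {z | z ∈ X ∧ proj h z = x}.Nontrivial}

/-- Embedded Aronszajn compacta `X ⊆ [0,1]^{ω₁}`. -/
structure IsEmbeddedAronszajnCompactum (X : Set (Cube ω₁)) : Prop where
  isClosed : IsClosed X
  weight_eq : weight X = ℵ₁
  character_eq : character X = ℵ₀
  exists_club : ∃ C : Set (Iio (ω₁ : Ordinal.{0})), IsClub C ∧
    ∀ α ∈ C, (level X (α := α.1) (le_of_lt α.2)).Countable

/-- Aronszajn compacta. -/
structure IsAronszajnCompactum (X : Type u) [TopologicalSpace X] : Prop where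
  t2 : T2Space X
  compact : CompactSpace X
  weight_eq : weight X = ℵ₁
  character_eq : character X = ℵ₀
  exists_embedded : ∃ Z : Set (Cube ω₁), IsEmbeddedAronszajnCompactum Z ∧ Nonempty (X ≃ₜ Z)

/-- Every subspace of `X` is separable (has a countable dense subset of its own). -/
def HereditarilySeparable (X : Type u) [TopologicalSpace X] : Prop :=
  ∀ S : Set X, SeparableSpace S

end Aronszajn

namespace Aronszajn

-- The space is an inverse limit of length ω₁ whose stages are closed sets in countably many `Bool`
-- coordinates, hence metrizable. At stage α countably many points `e n` are split: two closed sets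
-- `A n b` cover the stage and meet only in `e n`, and the new coordinate `(α, n)` records a side.
-- Later split points lie over earlier ones, so an unsplit point has exactly one point of the limit
-- over it; this is the Aronszajn property. Splitting at every stage makes the weight uncountable.
--
-- The heart is that each closed set H is captured at a countable stage. By ◇ there is a limit α at
-- which the guess `G α` is the projection of H (`exists_guess`). Cantor–Bendixson divides the guess
-- into a kernel `D` without isolated points and a countable remainder. The split points avoid the
-- remainder, so fibres over it are singletons. Whenever a point over `D` is split, now or later,
-- both sides contain points over `D` accumulating at it, so the projection onto `D` stays
-- irreducible (`irred_of_lt`): only the whole preimage of `D` is a closed subset of it mapping onto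
-- `D`. Hence a closed set whose projection covers that of H contains everything over it
-- (`isThin_limit`). Capturing reduces both hereditary properties and first countability to a
-- metrizable stage.

universe u v

/-! ### Recursion and a splitting colouring -/

/-- Recursive construction along a well-order, each value being chosen so as to be compatible with
the previous ones. -/
theorem exists_rec {W : Type*} [LinearOrder W] [WellFoundedLT W] {D : Type*} [Nonempty D]
    (P : W → (W → D) → D → Prop)
    (hcongr : ∀ α f g d, (∀ β < α, f β = g β) → P α f d → P α g d)
    (hstep : ∀ α f, (∀ β < α, P β f (f β)) → ∃ d, P α f d) :
    ∃ f : W → D, ∀ α, P α f (f α) := by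
  classical
  let d₀ : D := Classical.arbitrary D
  let F : (α : W) → ((β : W) → β < α → D) → D := fun α ih =>
    Classical.epsilon (P α (fun β => if h : β < α then ih β h else d₀))
  let f : W → D := (wellFounded_lt (α := W)).fix F
  have hf : ∀ α, f α = Classical.epsilon (P α (fun β => if β < α then f β else d₀)) := by
    intro α
    have := (wellFounded_lt (α := W)).fix_eq F α
    simp only [f]
    rw [this]
    simp only [F, dite_eq_ite]
  refine ⟨f, fun α => ?_⟩
  induction α using WellFoundedLT.induction with
  | ind α ih =>
    have hag : ∀ β < α, f β = (fun β => if β < α then f β else d₀) β := by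
      intro β hβ
      simp [hβ]
    obtain ⟨d, hd⟩ := hstep α f ih
    have h1 := Classical.epsilon_spec (p := P α (fun β => if β < α then f β else d₀))
      ⟨d, hcongr _ _ _ _ hag hd⟩
    rw [← hf] at h1
    exact hcongr _ _ _ _ (fun β hβ => (hag β hβ).symm) h1

/-- A function to `Bool` that takes both values infinitely often on each of countably many infinite
sets. -/
theorem exists_bool_splitting (N : Set (Set ℕ)) (hc : N.Countable) (hN : ∀ S ∈ N, S.Infinite) :
    ∃ f : ℕ → Bool, ∀ S ∈ N, ∀ b n, ∃ k ∈ S, n ≤ k ∧ f k = b := by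
  classical
  have : Countable N := hc
  -- A list of requests (set, colour): the factor `ℕ` repeats each of them infinitely often, and
  -- `none` keeps the list nonempty when `N` is empty. The increasing `φ` below answers request `i`
  -- by the point `φ i`.
  obtain ⟨g, hg⟩ := exists_surjective_nat (Option N × Bool × ℕ)
  obtain ⟨φ, hφ, h⟩ := Filter.extraction_forall_of_frequently
    (P := fun i k => ∀ S : N, (g i).1 = some S → k ∈ S.1) (by
      intro i
      cases h : (g i).1 with
      | none => exact Filter.Frequently.of_forall fun k S hS => by simp at hS
      | some S =>
        have := Nat.frequently_atTop_iff_infinite.2 (hN S.1 S.2)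
        refine this.mono fun k hk T hT => ?_
        rw [← Option.some.inj hT]
        exact hk)
  refine ⟨fun n => decide (∃ i, φ i = n ∧ (g i).2.1 = true), fun S hS b n => ?_⟩
  have hinf : {i | (g i).1 = some ⟨S, hS⟩ ∧ (g i).2.1 = b}.Infinite := by
    choose c hc using fun k => hg (some ⟨S, hS⟩, b, k)
    refine infinite_of_injective_forall_mem (f := c) (fun k l hkl => ?_) fun k => ?_
    · have := (hc k).symm.trans ((congrArg g hkl).trans (hc l))
      simpa using this
    · simp [hc k]
  obtain ⟨i, ⟨hi1, hi2⟩, hi⟩ := hinf.exists_gt n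
  refine ⟨φ i, h i _ hi1, hi.le.trans hφ.le_apply, ?_⟩
  cases b with
  | true => simpa using ⟨i, rfl, hi2⟩
  | false =>
    simp only [decide_eq_false_iff_not, not_exists, not_and]
    intro k hk
    rw [hφ.injective hk, hi2]
    simp

/-! ### Cantor cube modulo agreement below α -/

section Points

variable {W : Type v}

/-- Coordinates: those with first component `⊥` belong to the base space. -/
abbrev Idx (W : Type v) : Type v := WithBot W × ℕ

/-- Points of the Cantor cube in which the compactum is built. -/
abbrev Pt (W : Type v) : Type v := Idx W → Bool

theorem exists_finset_of_notMem {S : Set (Pt W)} (hS : IsClosed S) {x : Pt W} (hx : x ∉ S) :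
    ∃ F : Finset (Idx W), ∀ y, (∀ j ∈ F, y j = x j) → y ∉ S := by
  have h : Sᶜ ∈ 𝓝 x := hS.isOpen_compl.mem_nhds hx
  rw [nhds_pi, Filter.mem_pi'] at h
  obtain ⟨F, t, ht, hF⟩ := h
  refine ⟨F, fun y hy => hF fun j hj => ?_⟩
  rw [hy j hj]
  exact mem_of_mem_nhds (ht j)

theorem isClosed_coord (j : Idx W) (b : Bool) : IsClosed {x : Pt W | x j = b} :=
  isClosed_eq (continuous_apply j) continuous_const

theorem isOpen_coord (j : Idx W) (b : Bool) : IsOpen {x : Pt W | x j = b} :=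
  (isOpen_discrete {b}).preimage (continuous_apply j : Continuous fun x : Pt W => x j)

variable [LinearOrder W]

/-- `x` and `y` have the same coordinates below `α`. -/
def Agree (α : W) (x y : Pt W) : Prop := ∀ j : Idx W, j.1 < (α : WithBot W) → x j = y j

theorem Agree.refl (α : W) (x : Pt W) : Agree α x x := fun _ _ => rfl

theorem Agree.symm {α : W} {x y : Pt W} (h : Agree α x y) : Agree α y x :=
  fun j hj => (h j hj).symm

theorem Agree.trans {α : W} {x y z : Pt W} (h : Agree α x y) (h' : Agree α y z) : Agree α x z :=
  fun j hj => (h j hj).trans (h' j hj)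

theorem Agree.mono {α β : W} {x y : Pt W} (h : Agree β x y) (hab : α ≤ β) : Agree α x y :=
  fun j hj => h j (hj.trans_le (WithBot.coe_le_coe.2 hab))

/-- The set `S` depends only on the coordinates below `α`. -/
def IsCyl (α : W) (S : Set (Pt W)) : Prop := ∀ x y, Agree α x y → x ∈ S → y ∈ S

/-- Modulo agreement below `α`, the point `x` is an accumulation point of `S`. -/
def AccAt (α : W) (S : Set (Pt W)) (x : Pt W) : Prop :=
  ∀ F : Finset (Idx W), ∃ y ∈ S, (∀ j ∈ F, j.1 < (α : WithBot W) → y j = x j) ∧ ¬ Agree α y x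

/-- `α` is neither minimal nor a successor. -/
def IsLim (α : W) : Prop := (∃ β, β < α) ∧ ∀ β < α, ∃ γ < α, β < γ

theorem zero_or_succ_or_isLim (α : W) :
    (∀ β, ¬ β < α) ∨ (∃ β < α, ∀ γ < α, γ ≤ β) ∨ IsLim α := by
  unfold IsLim
  by_cases h : ∃ β, β < α
  · by_cases h' : ∃ β < α, ∀ γ < α, γ ≤ β
    · exact Or.inr (Or.inl h')
    · push Not at h'
      exact Or.inr (Or.inr ⟨h, h'⟩)
  · push Not at h
    exact Or.inl fun β => (h β).not_gt

theorem IsLim.exists_finset_bound {α : W} (hα : IsLim α) {δ : W} (hδ : δ < α)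
    (F : Finset (Idx W)) :
    ∃ β < α, δ < β ∧ ∀ j ∈ F, j.1 < (α : WithBot W) → j.1 < (β : WithBot W) := by
  classical
  induction F using Finset.induction_on with
  | empty =>
    obtain ⟨β, h, h'⟩ := hα.2 δ hδ
    exact ⟨β, h, h', by simp⟩
  | insert j F _ ih =>
    obtain ⟨β, h, h', hF⟩ := ih
    obtain ⟨⟨i⟩ | i, n⟩ := j
    · refine ⟨β, h, h', fun j hj hjα => ?_⟩
      rcases Finset.mem_insert.1 hj with rfl | hj
      · exact WithBot.bot_lt_coe β
      · exact hF j hj hjα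
    · by_cases hi : i < α
      · obtain ⟨γ, hγ, hγ'⟩ := hα.2 (max β i) (max_lt h hi)
        rw [max_lt_iff] at hγ'
        refine ⟨γ, hγ, h'.trans hγ'.1, fun j hj hjα => ?_⟩
        rcases Finset.mem_insert.1 hj with rfl | hj
        · exact WithBot.coe_lt_coe.2 hγ'.2
        · exact (hF j hj hjα).trans (WithBot.coe_lt_coe.2 hγ'.1)
      · refine ⟨β, h, h', fun j hj hjα => ?_⟩
        rcases Finset.mem_insert.1 hj with rfl | hj
        · exact absurd (WithBot.coe_lt_coe.1 hjα) hi
        · exact hF j hj hjα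

theorem IsCyl.exists_finset_of_notMem {α : W} {S : Set (Pt W)} (hc : IsCyl α S) (hS : IsClosed S)
    {x : Pt W} (hx : x ∉ S) :
    ∃ F : Finset (Idx W), ∀ y, (∀ j ∈ F, j.1 < (α : WithBot W) → y j = x j) → y ∉ S := by
  classical
  obtain ⟨F, hF⟩ := Aronszajn.exists_finset_of_notMem hS hx
  refine ⟨F, fun y hy hyS => ?_⟩
  refine hF (fun j => if j.1 < (α : WithBot W) then y j else x j) (fun j hj => ?_)
    (hc y _ (fun j hj => by simp [hj]) hyS)
  split_ifs with h
  exacts [hy j hj h, rfl]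

theorem countable_idx_lt (hI : ∀ α : W, (Iio α).Countable) (α : W) :
    {j : Idx W | j.1 < (α : WithBot W)}.Countable := by
  have h1 : (Iio (α : WithBot W)).Countable := by
    refine (((hI α).image ((↑) : W → WithBot W)).insert ⊥).mono ?_
    intro i hi
    induction i with
    | bot => simp
    | coe i => exact Or.inr ⟨i, WithBot.coe_lt_coe.1 hi, rfl⟩
  refine (h1.prod (countable_univ (α := ℕ))).mono ?_
  intro j hj
  exact ⟨hj, mem_univ _⟩

/-- Splitting a point `e`: the cube is divided, modulo agreement below `α`, into two closed sets that
have only `e` in common, and both of which contain a sequence from each of countably many given sets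
that accumulate at `e`. -/
theorem exists_split (hI : ∀ α : W, (Iio α).Countable) (α : W) (e : Pt W)
    (Q : Set (Set (Pt W))) (hQc : Q.Countable) (hQ : ∀ S ∈ Q, AccAt α S e) :
    ∃ A : Bool → Set (Pt W), (∀ b, IsClosed (A b)) ∧ (∀ b, IsCyl α (A b)) ∧
      (∀ x, ∃ b, x ∈ A b) ∧ (∀ x, (∀ b, x ∈ A b) ↔ Agree α x e) ∧
      ∀ S ∈ Q, ∀ b, AccAt α (S ∩ A b) e := by
  classical
  obtain ⟨u, hu⟩ := (countable_idx_lt hI α).exists_eq_range ⟨(⊥, 0), WithBot.bot_lt_coe α⟩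
  have hu1 : ∀ n, (u n).1 < (α : WithBot W) := fun n => by
    have : u n ∈ {j : Idx W | j.1 < (α : WithBot W)} := hu ▸ mem_range_self n
    exact this
  have hu2 : ∀ j : Idx W, j.1 < (α : WithBot W) → ∃ n, u n = j := fun j hj => by
    have : j ∈ range u := hu ▸ hj
    exact this
  -- `R x n`: in the enumeration `u` of the coordinates below α, `x` first leaves `e` at index `n`.
  -- The side of `x` will be the colour of `n`; `e` has no such index and so lies on both sides.
  let R : Pt W → ℕ → Prop := fun x n => (∀ i < n, x (u i) = e (u i)) ∧ x (u n) ≠ e (u n)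
  have hR : ∀ x, ¬ Agree α x e → ∃ n, R x n := by
    intro x hx
    have : ∃ n, x (u n) ≠ e (u n) := by
      by_contra! h
      refine hx fun j hj => ?_
      obtain ⟨n, rfl⟩ := hu2 j hj
      exact h n
    exact ⟨Nat.find this, fun i hi => not_not.1 (Nat.find_min this hi), Nat.find_spec this⟩
  have hRu : ∀ x n m, R x n → R x m → n = m := by
    intro x n m hn hm
    rcases lt_trichotomy n m with h | h | h
    · exact absurd (hm.1 n h) hn.2
    · exact h
    · exact absurd (hn.1 m h) hm.2
  have hRc : ∀ x y n, Agree α x y → R x n → R y n := by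
    intro x y n hxy hn
    refine ⟨fun i hi => (hxy _ (hu1 i)) ▸ hn.1 i hi, (hxy _ (hu1 n)) ▸ hn.2⟩
  have hRn : ∀ x n, R x n → ¬ Agree α x e := fun x n hn h => hn.2 (h _ (hu1 n))
  -- As `S` accumulates at `e`, the indices at which its points leave `e` are unbounded.
  obtain ⟨f, hf⟩ := exists_bool_splitting ((fun S => {n | ∃ y ∈ S, R y n}) '' Q) (hQc.image _) (by
    rintro _ ⟨S, hS, rfl⟩
    refine infinite_of_not_bddAbove ?_
    rintro ⟨n, hn⟩
    obtain ⟨y, hy, hyF, hye⟩ := hQ S hS ((Finset.range (n + 1)).image u)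
    obtain ⟨k, hk⟩ := hR y hye
    have hkn : k ≤ n := hn ⟨y, hy, hk⟩
    exact hk.2 (hyF _ (Finset.mem_image_of_mem _ (Finset.mem_range.2 (by omega))) (hu1 k)))
  refine ⟨fun b => {x | ∀ n, R x n → f n = b}, fun b => ?_, fun b => ?_, fun x => ?_, fun x => ?_,
    ?_⟩
  · have : {x | ∀ n, R x n → f n = b} = ⋂ n, {x | R x n → f n = b} := by ext; simp
    change IsClosed {x | ∀ n, R x n → f n = b}
    rw [this]
    refine isClosed_iInter fun n => ?_
    by_cases hb : f n = b
    · simp [hb]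
    · have : {x | R x n → f n = b} =
          (⋂ i ∈ Iio n, {x : Pt W | x (u i) = e (u i)})ᶜ ∪ {x | x (u n) = e (u n)} := by
        ext x
        simp only [R, hb, imp_false, mem_ofPred_eq, mem_union, mem_compl_iff, mem_iInter, mem_Iio]
        tauto
      rw [this]
      exact ((finite_Iio n).isOpen_biInter fun i _ => isOpen_coord _ _).isClosed_compl.union
        (isClosed_coord _ _)
  · exact fun x y hxy hx n hn => hx n (hRc y x n hxy.symm hn)
  · by_cases hx : Agree α x e
    · exact ⟨true, fun n hn => absurd hx (hRn x n hn)⟩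
    · obtain ⟨n, hn⟩ := hR x hx
      exact ⟨f n, fun m hm => congrArg f (hRu x m n hm hn)⟩
  · constructor
    · intro h
      by_contra hx
      obtain ⟨n, hn⟩ := hR x hx
      have h1 := h true n hn
      have h2 := h false n hn
      simp [h1] at h2
    · exact fun hx b n hn => absurd hx (hRn x n hn)
  · intro S hS b F
    have hF : ∃ n, ∀ j ∈ F, j.1 < (α : WithBot W) → ∃ i < n, u i = j := by
      choose! c hc using hu2
      refine ⟨F.sup c + 1, fun j hj hjα => ⟨c j, Nat.lt_succ_of_le (Finset.le_sup hj), hc j hjα⟩⟩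
    obtain ⟨n, hn⟩ := hF
    obtain ⟨k, ⟨y, hy, hyk⟩, hnk, hfk⟩ := hf _ ⟨S, hS, rfl⟩ b n
    refine ⟨y, ⟨hy, fun m hm => (congrArg f (hRu y m k hm hyk)).trans hfk⟩, fun j hj hjα => ?_,
      hRn y k hyk⟩
    obtain ⟨i, hi, rfl⟩ := hn j hj hjα
    exact hyk.1 i (hi.trans_le hnk)

/-- Cantor–Bendixson theorem, modulo agreement below `α`. -/
theorem exists_perfect_kernel (hI : ∀ α : W, (Iio α).Countable) (α : W) (K : Set (Pt W))
    (hK : IsClosed K) (hc : IsCyl α K) :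
    ∃ D V : Set (Pt W), V.Countable ∧ D ⊆ K ∧ IsCyl α D ∧ (∀ x ∈ D, AccAt α D x) ∧
      ∀ x ∈ K, x ∈ D ∨ ∃ v ∈ V, Agree α x v := by
  classical
  -- Modulo agreement below α the cube is `J → Bool` with `J` countable, where the classical theorem
  -- applies.
  let J := {j : Idx W // j.1 < (α : WithBot W)}
  have : Countable J := countable_idx_lt hI α
  let res : Pt W → (J → Bool) := fun x j => x j.1
  let ext : (J → Bool) → Pt W := fun x j => if h : j.1 < (α : WithBot W) then x ⟨j, h⟩ else false
  have hext : Continuous ext := by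
    refine continuous_pi fun j => ?_
    by_cases h : j.1 < (α : WithBot W)
    · simpa only [ext, h, dite_true] using continuous_apply _
    · simpa only [ext, h, dite_false] using continuous_const
  have hre : ∀ x, Agree α x (ext (res x)) := fun x j hj => by simp [ext, res, hj]
  have her : ∀ y, res (ext y) = y := fun y => by
    funext j
    simp [ext, res, j.2]
  have hres : ∀ x y, res x = res y ↔ Agree α x y := fun x y =>
    ⟨fun h j hj => congrFun h ⟨j, hj⟩, fun h => funext fun j => h j.1 j.2⟩
  obtain ⟨V, D, hV, hD, hVD⟩ := exists_countable_union_perfect_of_isClosed (hK.preimage hext)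
  refine ⟨res ⁻¹' D, ext '' V, hV.image _, fun x hx => ?_, fun x y hxy hx => ?_, fun x hx F => ?_,
    fun x hx => ?_⟩
  · have : res x ∈ ext ⁻¹' K := hVD ▸ Or.inr hx
    exact hc _ _ (hre x).symm this
  · rw [mem_preimage, ← (hres x y).2 hxy]
    exact hx
  · have hacc := accPt_iff_nhds.1 (hD.acc (res x) hx)
    obtain ⟨y, ⟨hyU, hyD⟩, hyx⟩ := hacc (⋂ j ∈ F, {y | ext y j = ext (res x) j}) (by
      refine (Filter.biInter_finset_mem F).2 fun j _ => ?_
      refine IsOpen.mem_nhds ?_ rfl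
      exact (isOpen_discrete {ext (res x) j}).preimage ((continuous_apply j).comp hext))
    refine ⟨ext y, by rwa [mem_preimage, her], fun j hj hjα => ?_, fun h => hyx ?_⟩
    · exact (mem_iInter₂.1 hyU j hj).trans (hre x j hjα).symm
    · rw [← her y]
      exact (hres _ _).2 h
  · have : res x ∈ V ∪ D := hVD ▸ hc _ _ (hre x) hx
    rcases this with h | h
    · exact Or.inr ⟨_, ⟨_, h, rfl⟩, hre x⟩
    · exact Or.inl h

end Points

/-! ### Stages of the inverse system and irreducibility -/

section Stages

variable {W : Type v} [LinearOrder W]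

/-- What is chosen at one stage of the construction: the points `e n` that are to be split, for each
of them a division of the cube into two closed sets `A n b`, and the perfect kernel `D` of the guessed
closed set. -/
structure StageData (W : Type v) where
  e : ℕ → Pt W
  A : ℕ → Bool → Set (Pt W)
  D : Set (Pt W)

instance : Nonempty (StageData W) := ⟨⟨fun _ _ => false, fun _ _ => ∅, ∅⟩⟩

/-- The points that satisfy all requirements of the stages below `α`. -/
def Stage (f : W → StageData W) (α : W) : Set (Pt W) :=
  {x | ∀ β < α, ∀ n, x ∈ (f β).A n (x (β, n))}

/-- The requirements on the choices made at stage `α`, given those made before; `G α` is the closed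
set guessed at stage `α`. -/
structure Good (G : W → Set (Pt W)) (α : W) (f : W → StageData W) (d : StageData W) : Prop where
  e_mem : ∀ n, d.e n ∈ Stage f α
  e_inj : ∀ n m, Agree α (d.e n) (d.e m) → n = m
  e_proj : ∀ β < α, ∀ n, ∃ m, Agree β (d.e n) ((f β).e m)
  e_ext : ∀ β < α, ∀ m b, ∃ n, Agree β (d.e n) ((f β).e m) ∧ d.e n (β, m) = b
  A_closed : ∀ n b, IsClosed (d.A n b)
  A_cyl : ∀ n b, IsCyl α (d.A n b)
  A_cover : ∀ n x, ∃ b, x ∈ d.A n b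
  A_inter : ∀ n x, (∀ b, x ∈ d.A n b) ↔ Agree α x (d.e n)
  D_cyl : IsCyl α d.D
  D_sub : d.D ⊆ Stage f α ∩ G α
  D_acc : ∀ x ∈ d.D, AccAt α d.D x
  scattered : IsLim α → ∀ x ∈ Stage f α ∩ G α, x ∈ d.D ∨ ∀ n, ¬ Agree α x (d.e n)
  acc_self : ∀ n b, d.e n ∈ d.D → AccAt α (d.D ∩ d.A n b) (d.e n)
  acc_lt : ∀ n b, ∀ δ < α, d.e n ∈ (f δ).D →
    AccAt α ((f δ).D ∩ Stage f α ∩ d.A n b) (d.e n)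

theorem stage_congr {f g : W → StageData W} {α : W} (h : ∀ β < α, f β = g β) :
    Stage f α = Stage g α := by
  ext x
  refine forall₂_congr fun β hβ => ?_
  rw [h β hβ]

theorem Stage.mono {f : W → StageData W} {α β : W} (h : α ≤ β) : Stage f β ⊆ Stage f α :=
  fun _ hx γ hγ => hx γ (hγ.trans_le h)

theorem Good.congr {G : W → Set (Pt W)} {α : W} {f g : W → StageData W} {d : StageData W}
    (h : ∀ β < α, f β = g β) (hd : Good G α f d) : Good G α g d where
  e_mem := stage_congr h ▸ hd.e_mem
  e_inj := hd.e_inj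
  e_proj β hβ := h β hβ ▸ hd.e_proj β hβ
  e_ext β hβ := h β hβ ▸ hd.e_ext β hβ
  A_closed := hd.A_closed
  A_cyl := hd.A_cyl
  A_cover := hd.A_cover
  A_inter := hd.A_inter
  D_cyl := hd.D_cyl
  D_sub := stage_congr h ▸ hd.D_sub
  D_acc := hd.D_acc
  scattered := stage_congr h ▸ hd.scattered
  acc_self := hd.acc_self
  acc_lt n b δ hδ := stage_congr h ▸ h δ hδ ▸ hd.acc_lt n b δ hδ

theorem stage_isCyl {f : W → StageData W} {α : W}
    (hA : ∀ β < α, ∀ n b, IsCyl β ((f β).A n b)) : IsCyl α (Stage f α) := by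
  intro x y hxy hx β hβ n
  rw [← hxy (β, n) (WithBot.coe_lt_coe.2 hβ)]
  exact hA β hβ n _ x y (hxy.mono hβ.le) (hx β hβ n)

theorem stage_isClosed {f : W → StageData W} {α : W}
    (hA : ∀ β < α, ∀ n b, IsClosed ((f β).A n b)) : IsClosed (Stage f α) := by
  have : Stage f α = ⋂ β, ⋂ (_ : β < α), ⋂ n, ⋂ b : Bool,
      {x : Pt W | x (β, n) = !b} ∪ (f β).A n b := by
    ext x
    simp only [Stage, mem_ofPred_eq, mem_iInter, mem_union]
    refine forall₃_congr fun β _ n => ?_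
    cases h : x (β, n) <;> simp
  rw [this]
  exact isClosed_iInter fun β => isClosed_iInter fun hβ => isClosed_iInter fun n =>
    isClosed_iInter fun b => (isClosed_coord _ _).union (hA β hβ n b)

/-- A point of one stage extends to a point that meets the requirements of further stages. -/
theorem exists_lift [WellFoundedLT W] (f : W → StageData W) (S : Set W)
    (hcyl : ∀ β ∈ S, ∀ n b, IsCyl β ((f β).A n b)) (hcov : ∀ β ∈ S, ∀ n x, ∃ b, x ∈ (f β).A n b)
    (δ : W) (x : Pt W) (hx : x ∈ Stage f δ) :
    ∃ z, Agree δ z x ∧ ∀ β ∈ S, ∀ n, z ∈ (f β).A n (z (β, n)) := by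
  let mk : (W → ℕ → Bool) → Pt W := fun g j => WithBot.recBotCoe (x (⊥, j.2)) (fun i => g i j.2) j.1
  have hmk : ∀ g (β : W) n, mk g (β, n) = g β n := fun _ _ _ => rfl
  have hag : ∀ α g g', (∀ β < α, g β = g' β) → Agree α (mk g) (mk g') := by
    rintro α g g' h ⟨i, n⟩ hi
    induction i with
    | bot => rfl
    | coe i => exact congrFun (h i (WithBot.coe_lt_coe.1 hi)) n
  -- Below `δ` the bits of `x` are copied; from `δ` on, each is a side containing the point built so
  -- far. The sides at α are cylinders, so later bits cannot spoil the choice.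
  obtain ⟨g, hg⟩ := exists_rec (W := W) (D := ℕ → Bool)
    (fun α g d => (α < δ → ∀ n, d n = x (α, n)) ∧
      (α ∈ S → δ ≤ α → ∀ n, mk g ∈ (f α).A n (d n)))
    (fun α g g' d h hd => ⟨hd.1, fun hS hδ n => hcyl α hS _ _ _ _ (hag α _ _ h) (hd.2 hS hδ n)⟩)
    (fun α g _ => by
      by_cases hδ : α < δ
      · exact ⟨fun n => x (α, n), fun _ _ => rfl, fun _ h => absurd hδ h.not_gt⟩
      · by_cases hS : α ∈ S
        · choose b hb using fun n => hcov α hS n (mk g)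
          exact ⟨b, fun h => absurd h hδ, fun _ _ => hb⟩
        · exact ⟨fun _ => false, fun h => absurd h hδ, fun h => absurd h hS⟩)
  have hδx : Agree δ (mk g) x := by
    rintro ⟨i, n⟩ hi
    induction i with
    | bot => rfl
    | coe i => exact (hg i).1 (WithBot.coe_lt_coe.1 hi) n
  refine ⟨mk g, hδx, fun β hβ n => ?_⟩
  by_cases h : β < δ
  · rw [hδx (β, n) (WithBot.coe_lt_coe.2 h)]
    exact hcyl β hβ _ _ _ _ (hδx.mono h.le).symm (hx β h n)
  · exact (hg β).2 hβ (not_lt.1 h) n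

variable {G : W → Set (Pt W)} {f : W → StageData W} {α : W}

theorem Good.acc (h : Good G α f (f α)) (n : ℕ) (b : Bool) {δ : W} (hδ : δ ≤ α)
    (hn : (f α).e n ∈ (f δ).D) :
    AccAt α ((f δ).D ∩ Stage f α ∩ (f α).A n b) ((f α).e n) := by
  rcases hδ.lt_or_eq with hδ | rfl
  · exact h.acc_lt n b δ hδ hn
  · rw [inter_eq_left.2 (h.D_sub.trans inter_subset_left)]
    exact h.acc_self n b hn

theorem Good.mem_iff (h : Good G α f (f α)) {n : ℕ} {x : Pt W} {b c : Bool}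
    (hb : x ∈ (f α).A n b) (hx : ¬ Agree α x ((f α).e n)) : x ∈ (f α).A n c ↔ c = b := by
  refine ⟨fun hc => ?_, fun hc => hc ▸ hb⟩
  by_contra hcb
  refine hx ((h.A_inter n x).1 fun a => ?_)
  rcases Bool.eq_or_eq_not a b with rfl | ha
  · exact hb
  · rwa [ha, ← Bool.eq_not_of_ne hcb]

/-- The projection from the part of stage `α` over `(f δ).D` to `(f δ).D` is irreducible. -/
def Irred (f : W → StageData W) (δ α : W) : Prop :=
  ∀ x ∈ (f δ).D ∩ Stage f α, ∀ F : Finset (Idx W), ∃ x' ∈ (f δ).D, ∃ F' : Finset (Idx W),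
    ∀ y ∈ (f δ).D ∩ Stage f α, (∀ j ∈ F', j.1 < (δ : WithBot W) → y j = x' j) →
      ∀ j ∈ F, j.1 < (α : WithBot W) → y j = x j

/-- Only a point `x` over some split `e m` is problematic, as its neighbours over the same stage-β
point may lie on the other side. Then `x` is replaced by a nearby point over the kernel, strictly on
the chosen side of `A m`. There all relevant new bits are forced throughout a stage-β neighbourhood,
to which irreducibility at β applies. -/
theorem irred_succ {β δ : W} (hf : Good G β f (f β)) (hcyl : IsCyl β (f δ).D)
    (hδ : δ ≤ β)
    (hβα : β < α) (hα : ∀ γ < α, γ ≤ β) (h : Irred f δ β) : Irred f δ α := by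
  classical
  rintro x ⟨hxD, hxα⟩ F
  have hxβ : x ∈ Stage f β := Stage.mono hβα.le hxα
  let N := F.image Prod.snd
  have hx' : ∃ x' ∈ (f δ).D ∩ Stage f β, (∀ j ∈ F, j.1 < (β : WithBot W) → x' j = x j) ∧
      ∀ n ∈ N, x' ∉ (f β).A n (!x (β, n)) := by
    by_cases hx : ∃ m, Agree β x ((f β).e m)
    · obtain ⟨m, hm⟩ := hx
      have hn : ∀ n, n ≠ m → x ∉ (f β).A n (!x (β, n)) := by
        intro n hn hxn
        have hne : ¬ Agree β x ((f β).e n) := fun hxn' => hn (hf.e_inj _ _ (hxn'.symm.trans hm))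
        have := (hf.mem_iff (hxα β hβα n) hne).1 hxn
        simp at this
      choose! E hE using fun n hnm => (hf.A_cyl n _).exists_finset_of_notMem (hf.A_closed n _)
        (hn n hnm)
      obtain ⟨y, hy, hyF, hye⟩ := hf.acc m (x (β, m)) hδ (hcyl _ _ hm hxD) (F ∪ N.biUnion E)
      refine ⟨y, hy.1, fun j hj hjβ => ?_, fun n hnN => ?_⟩
      · rw [hyF j (Finset.mem_union_left _ hj) hjβ, hm j hjβ]
      · by_cases hnm : n = m
        · subst hnm
          intro hyn
          have := (hf.mem_iff hy.2 hye).1 hyn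
          simp at this
        · refine hE n hnm y fun j hj hjβ => ?_
          rw [hyF j (Finset.mem_union_right _ (Finset.mem_biUnion.2 ⟨n, hnN, hj⟩)) hjβ, hm j hjβ]
    · push Not at hx
      refine ⟨x, ⟨hxD, hxβ⟩, fun _ _ _ => rfl, fun n _ hn => ?_⟩
      have := (hf.mem_iff (hxα β hβα n) (hx n)).1 hn
      simp at this
  obtain ⟨x', hx'D, hx'F, hx'N⟩ := hx'
  choose! E hE using fun n (hn : n ∈ N) =>
    (hf.A_cyl n (!x (β, n))).exists_finset_of_notMem (hf.A_closed n _) (hx'N n hn)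
  obtain ⟨x'', hx'', F', hF'⟩ := h x' hx'D (F ∪ N.biUnion E)
  refine ⟨x'', hx'', F', fun y hy hyF' j hj hjα => ?_⟩
  have hyF := hF' y ⟨hy.1, Stage.mono hβα.le hy.2⟩ hyF'
  by_cases hjβ : j.1 < (β : WithBot W)
  · rw [hyF j (Finset.mem_union_left _ hj) hjβ, hx'F j hj hjβ]
  · obtain ⟨i, n⟩ := j
    have hi : i = β := by
      induction i with
      | bot => exact absurd (WithBot.bot_lt_coe β) hjβ
      | coe i =>
        refine congrArg _ (le_antisymm (hα i (WithBot.coe_lt_coe.1 hjα)) ?_)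
        exact WithBot.coe_le_coe.1 (not_lt.1 hjβ)
    subst hi
    have hnN : n ∈ N := Finset.mem_image.2 ⟨_, hj, rfl⟩
    have hyn := hE n hnN y fun j hj hjβ =>
      hyF j (Finset.mem_union_right _ (Finset.mem_biUnion.2 ⟨n, hnN, hj⟩)) hjβ
    by_contra hne
    rw [← Bool.eq_not_of_ne hne] at hyn
    exact hyn (hy.2 β hβα n)

variable [WellFoundedLT W]

theorem exists_mem_stage (hf : ∀ β < α, Good G β f (f β)) {δ : W} {x : Pt W}
    (hx : x ∈ Stage f δ) : ∃ z ∈ Stage f α, Agree δ z x := by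
  obtain ⟨z, h1, h2⟩ := exists_lift f (Iio α) (fun β hβ => (hf β hβ).A_cyl)
    (fun β hβ => (hf β hβ).A_cover) δ x hx
  exact ⟨z, h2, h1⟩

/-- The fibre over a point that is not split is a singleton. -/
theorem agree_of_forall_not_agree (hf : ∀ β < α, Good G β f (f β)) {γ : W} {z w : Pt W}
    (hz : z ∈ Stage f α) (hw : w ∈ Stage f α) (hzw : Agree γ z w)
    (hγ : ∀ n, ¬ Agree γ z ((f γ).e n)) : Agree α z w := by
  have key : ∀ β < α, ∀ n, z (β, n) = w (β, n) := by
    intro β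
    induction β using WellFoundedLT.induction with
    | ind β ih =>
      intro hβ n
      by_cases hβγ : β < γ
      · exact hzw (β, n) (WithBot.coe_lt_coe.2 hβγ)
      have hag : Agree β z w := by
        rintro ⟨i, m⟩ hi
        induction i with
        | bot => exact hzw _ (WithBot.bot_lt_coe γ)
        | coe i =>
          have hi' := WithBot.coe_lt_coe.1 hi
          exact ih i hi' (hi'.trans hβ) m
      -- A split at `β` would project to a split at `γ`.
      have hne : ¬ Agree β z ((f β).e n) := by
        intro h
        rcases (not_lt.1 hβγ).lt_or_eq with h' | rfl
        · obtain ⟨m, hm⟩ := (hf β hβ).e_proj γ h' n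
          exact hγ m ((h.mono h'.le).trans hm)
        · exact hγ n h
      have h1 := hz β hβ n
      have h2 := (hf β hβ).A_cyl n _ _ _ hag.symm (hw β hβ n)
      exact (((hf β hβ).mem_iff h1 hne).1 h2).symm
  rintro ⟨i, m⟩ hi
  induction i with
  | bot => exact hzw _ (WithBot.bot_lt_coe γ)
  | coe i => exact key i (WithBot.coe_lt_coe.1 hi) m

theorem irred_of_lt {δ : W} (hf : ∀ β < α, Good G β f (f β)) (hδ : δ < α) : Irred f δ α := by
  have : ∀ β, δ ≤ β → β ≤ α → Irred f δ β := by
    intro β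
    induction β using WellFoundedLT.induction with
    | ind β ih =>
      intro hδβ hβα
      rcases hδβ.lt_or_eq with hδβ | rfl
      · rcases zero_or_succ_or_isLim β with h | ⟨γ, hγ, h⟩ | h
        · exact absurd hδβ (h δ)
        · have hδγ := h δ hδβ
          exact irred_succ (hf γ (hγ.trans_le hβα))
            (fun x y hxy => (hf δ hδ).D_cyl x y (hxy.mono hδγ)) hδγ hγ h
            (ih γ hγ hδγ (hγ.le.trans hβα))
        · rintro x ⟨hxD, hx⟩ F
          obtain ⟨γ, hγ, hδγ, hF⟩ := h.exists_finset_bound hδβ F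
          obtain ⟨x', hx', F', hF'⟩ :=
            ih γ hγ hδγ.le (hγ.le.trans hβα) x ⟨hxD, Stage.mono hγ.le hx⟩ F
          exact ⟨x', hx', F', fun y hy hyF' j hj hjβ =>
            hF' y ⟨hy.1, Stage.mono hγ.le hy.2⟩ hyF' j hj (hF j hj hjβ)⟩
      · exact fun x hx F => ⟨x, hx.1, F, fun y _ hy => hy⟩
  exact this α hδ.le le_rfl

/-- A neighbourhood of `x` contains, by irreducibility, all points over a nonempty open part of the
kernel. That part has two distinct points, and their lifts cannot both be `x`. This lets the next
splitting place accumulating sequences on both sides. -/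
theorem accAt_of_lt {δ : W} (hf : ∀ β < α, Good G β f (f β)) (hδ : δ < α) {x : Pt W}
    (hx : x ∈ (f δ).D ∩ Stage f α) : AccAt α ((f δ).D ∩ Stage f α) x := by
  intro F
  obtain ⟨u, hu, F', hF'⟩ := irred_of_lt hf hδ x hx F
  obtain ⟨v, hv, hvu, hne⟩ := (hf δ hδ).D_acc u hu F'
  obtain ⟨u', hu', huu'⟩ := exists_mem_stage hf ((hf δ hδ).D_sub hu).1
  obtain ⟨v', hv', hvv'⟩ := exists_mem_stage hf ((hf δ hδ).D_sub hv).1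
  have hu'D := (hf δ hδ).D_cyl _ _ huu'.symm hu
  have hv'D := (hf δ hδ).D_cyl _ _ hvv'.symm hv
  by_cases h : Agree α u' x
  · refine ⟨v', ⟨hv'D, hv'⟩, hF' v' ⟨hv'D, hv'⟩ fun j hj hjδ => ?_, fun h' => hne ?_⟩
    · rw [hvv' j hjδ, hvu j hj hjδ]
    · exact hvv'.symm.trans (((h'.trans h.symm).mono hδ.le).trans huu')
  · exact ⟨u', ⟨hu'D, hu'⟩, hF' u' ⟨hu'D, hu'⟩ fun j _ hjδ => huu' j hjδ, h⟩

end Stages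

/-! ### Choice of split points and existence of all stages -/

section Branches

variable {W : Type v} [LinearOrder W]

/-- `x` is a point of stage `α` all of whose projections to earlier stages are split there. -/
def IsBranch (f : W → StageData W) (α : W) (x : Pt W) : Prop :=
  x ∈ Stage f α ∧ ∀ β < α, ∃ m, Agree β x ((f β).e m)

variable {G : W → Set (Pt W)} {f : W → StageData W} {α : W}

theorem IsBranch.congr (hf : ∀ β < α, Good G β f (f β)) {x y : Pt W} (h : Agree α x y)
    (hx : IsBranch f α x) : IsBranch f α y := by
  refine ⟨stage_isCyl (fun β hβ => (hf β hβ).A_cyl) _ _ h hx.1, fun β hβ => ?_⟩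
  obtain ⟨m, hm⟩ := hx.2 β hβ
  exact ⟨m, (h.mono hβ.le).symm.trans hm⟩

theorem exists_branch_succ {β : W} (hf : ∀ β < α, Good G β f (f β)) (hβα : β < α)
    (hα : ∀ γ < α, γ ≤ β) (m : ℕ) (b : Bool) :
    ∃ x, IsBranch f α x ∧ Agree β x ((f β).e m) ∧ x (β, m) = b := by
  classical
  have hg := hf β hβα
  -- The bit `m` is free because `e m` lies in both halves `A m`.
  have hbits : ∃ c : ℕ → Bool, c m = b ∧ ∀ n, (f β).e m ∈ (f β).A n (c n) := by
    choose c hc using fun n => hg.A_cover n ((f β).e m)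
    refine ⟨Function.update c m b, Function.update_self .., fun n => ?_⟩
    by_cases hn : n = m
    · subst hn
      exact (hg.A_inter n _).2 (Agree.refl _ _) _
    · rw [Function.update_of_ne hn]
      exact hc n
  obtain ⟨c, hcm, hc⟩ := hbits
  let x : Pt W := fun j => if j.1 < (β : WithBot W) then (f β).e m j else c j.2
  have hx : Agree β x ((f β).e m) := fun j hj => by simp [x, hj]
  have hxβ : ∀ n, x (β, n) = c n := fun n => by simp [x]
  refine ⟨x, ⟨fun γ hγ n => ?_, fun γ hγ => ?_⟩, hx, by rw [hxβ, hcm]⟩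
  · rcases (hα γ hγ).lt_or_eq with h | rfl
    · rw [hx _ (WithBot.coe_lt_coe.2 h)]
      exact (hf γ hγ).A_cyl _ _ _ _ (hx.mono h.le).symm (hg.e_mem m γ h n)
    · rw [hxβ]
      exact hg.A_cyl _ _ _ _ hx.symm (hc n)
  · rcases (hα γ hγ).lt_or_eq with h | rfl
    · obtain ⟨k, hk⟩ := hg.e_proj γ h m
      exact ⟨k, (hx.mono h.le).trans hk⟩
    · exact ⟨m, hx⟩

/-- A branch climbs through split points cofinally in α. At each step `e_ext` leaves one bit free,
and setting it against the next element of `V` diagonalizes out of `V`. At a successor there is no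
such freedom, which is why the scattered part is avoided at limits only. -/
theorem exists_branch_limit (hI : ∀ α : W, (Iio α).Countable) (hf : ∀ β < α, Good G β f (f β))
    (hα : IsLim α) {V : Set (Pt W)} (hV : V.Countable) {β : W} (hβ : β < α) (m : ℕ) (b : Bool) :
    ∃ x, IsBranch f α x ∧ Agree β x ((f β).e m) ∧ x (β, m) = b ∧ ∀ v ∈ V, ¬ Agree α x v := by
  classical
  obtain ⟨u, hu⟩ := (hI α).exists_eq_range ⟨β, hβ⟩
  have hu1 : ∀ k, u k < α := fun k => by
    have : u k ∈ Iio α := hu ▸ mem_range_self k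
    exact this
  obtain ⟨v, hv⟩ := (hV.insert fun _ => false).exists_eq_range (insert_nonempty _ _)
  let T := {p : W × ℕ // p.1 < α}
  have hnext : ∀ (c : Bool) (w : W) (p : T), w < α → ∃ q : T, p.1.1 < q.1.1 ∧ w < q.1.1 ∧
      Agree p.1.1 ((f q.1.1).e q.1.2) ((f p.1.1).e p.1.2) ∧
      (f q.1.1).e q.1.2 (p.1.1, p.1.2) = c := by
    rintro c w ⟨⟨β, m⟩, hβ⟩ hw
    obtain ⟨γ, hγ, hγ'⟩ := hα.2 (max β w) (max_lt hβ hw)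
    rw [max_lt_iff] at hγ'
    obtain ⟨n, hn, hn'⟩ := (hf γ hγ).e_ext β hγ'.1 m c
    exact ⟨⟨(γ, n), hγ⟩, hγ'.1, hγ'.2, hn, hn'⟩
  -- The first step is spent on the prescribed bit `b`, before the diagonalization begins.
  obtain ⟨p₀, hp1, -, hp2, hp3⟩ := hnext b β ⟨(β, m), hβ⟩ hβ
  choose next hn1 hn2 hn3 hn4 using fun (k : ℕ) (p : T) =>
    hnext (!v k (p.1.1, p.1.2)) (u k) p (hu1 k)
  let s : ℕ → T := fun k => Nat.rec p₀ next k
  have hs : ∀ k, s (k + 1) = next k (s k) := fun _ => rfl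
  let p : ℕ → Pt W := fun k => (f (s k).1.1).e (s k).1.2
  have hmono : StrictMono fun k => (s k).1.1 := strictMono_nat_of_lt_succ fun k => hn1 k (s k)
  have hag : ∀ k l, k ≤ l → Agree (s k).1.1 (p l) (p k) := by
    intro k l hkl
    induction l, hkl using Nat.le_induction with
    | base => exact Agree.refl _ _
    | succ l hkl ih => exact ((hn3 l (s l)).mono (hmono.monotone hkl)).trans ih
  let x : Pt W := fun j =>
    if h : ∃ k, j.1 < ((s k).1.1 : WithBot W) then p (Nat.find h) j else false
  have hx : ∀ k, Agree (s k).1.1 x (p k) := by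
    intro k j hj
    have h : ∃ k, j.1 < ((s k).1.1 : WithBot W) := ⟨k, hj⟩
    simp only [x, h, dite_true]
    exact (hag _ k (Nat.find_min' h hj) j (Nat.find_spec h)).symm
  have hcof : ∀ γ < α, ∃ k, γ < (s k).1.1 := by
    intro γ hγ
    have : γ ∈ range u := hu ▸ hγ
    obtain ⟨k, rfl⟩ := this
    exact ⟨k + 1, hn2 k (s k)⟩
  refine ⟨x, ⟨fun γ hγ n => ?_, fun γ hγ => ?_⟩, ?_, ?_, fun w hw hxw => ?_⟩
  · obtain ⟨k, hk⟩ := hcof γ hγ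
    rw [hx k _ (WithBot.coe_lt_coe.2 hk)]
    exact (hf γ hγ).A_cyl _ _ _ _ ((hx k).mono hk.le).symm ((hf _ (s k).2).e_mem _ γ hk n)
  · obtain ⟨k, hk⟩ := hcof γ hγ
    obtain ⟨n, hn⟩ := (hf _ (s k).2).e_proj γ hk (s k).1.2
    exact ⟨n, ((hx k).mono hk.le).trans hn⟩
  · exact ((hx 0).mono hp1.le).trans hp2
  · rw [hx 0 _ (WithBot.coe_lt_coe.2 hp1)]
    exact hp3
  · have : w ∈ range v := hv ▸ Or.inr hw
    obtain ⟨k, rfl⟩ := this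
    have h1 := hx (k + 1) ((s k).1.1, (s k).1.2) (WithBot.coe_lt_coe.2 (hn1 k (s k)))
    have h2 := hxw ((s k).1.1, (s k).1.2) (WithBot.coe_lt_coe.2 (s k).2)
    have h3 : p (k + 1) ((s k).1.1, (s k).1.2) = _ := hn4 k (s k)
    rw [h1, h3] at h2
    simp at h2

theorem exists_branch (hI : ∀ α : W, (Iio α).Countable) (hf : ∀ β < α, Good G β f (f β))
    {V : Set (Pt W)} (hV : V.Countable) {β : W} (hβ : β < α) (m : ℕ) (b : Bool) :
    ∃ x, IsBranch f α x ∧ Agree β x ((f β).e m) ∧ x (β, m) = b ∧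
      (IsLim α → ∀ v ∈ V, ¬ Agree α x v) := by
  rcases zero_or_succ_or_isLim α with h | ⟨γ, hγ, h⟩ | h
  · exact absurd hβ (h β)
  · have hlim : ¬ IsLim α := fun hl => by
      obtain ⟨δ, hδ, hδ'⟩ := hl.2 γ hγ
      exact hδ'.not_ge (h δ hδ)
    rcases (h β hβ).lt_or_eq with hβγ | rfl
    · obtain ⟨n, hn, hnb⟩ := (hf γ hγ).e_ext β hβγ m b
      obtain ⟨x, hx, hxn, -⟩ := exists_branch_succ hf hγ h n b
      refine ⟨x, hx, (hxn.mono hβγ.le).trans hn, ?_, fun hl => absurd hl hlim⟩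
      rw [hxn _ (WithBot.coe_lt_coe.2 hβγ), hnb]
    · obtain ⟨x, hx, hxm, hxb⟩ := exists_branch_succ hf hγ h m b
      exact ⟨x, hx, hxm, hxb, fun hl => absurd hl hlim⟩
  · obtain ⟨x, hx, hxm, hxb, hxV⟩ := exists_branch_limit hI hf h hV hβ m b
    exact ⟨x, hx, hxm, hxb, fun _ => hxV⟩

/-- The points that are to be split at stage `α`. -/
theorem exists_split_points (hI : ∀ α : W, (Iio α).Countable) (hf : ∀ β < α, Good G β f (f β))
    {V : Set (Pt W)} (hV : V.Countable) :
    ∃ e : ℕ → Pt W, (∀ n, IsBranch f α (e n)) ∧ (∀ n m, Agree α (e n) (e m) → n = m) ∧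
      (∀ β < α, ∀ m b, ∃ n, Agree β (e n) ((f β).e m) ∧ e n (β, m) = b) ∧
      (IsLim α → ∀ n, ∀ v ∈ V, ¬ Agree α (e n) v) := by
  classical
  by_cases h0 : ∃ β₀, β₀ < α
  · obtain ⟨β₀, hβ₀⟩ := h0
    choose X hX1 hX2 hX3 hX4 using fun t : Iio α × ℕ × Bool =>
      exists_branch hI hf hV t.1.2 t.2.1 t.2.2
    -- Truncation turns agreement below α into equality, so the branches can be enumerated without
    -- repetition.
    let tr : Pt W → Pt W := fun x j => if j.1 < (α : WithBot W) then x j else false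
    have htr : ∀ x, Agree α x (tr x) := fun x j hj => by simp [tr, hj]
    have htr' : ∀ x y, Agree α x y → tr x = tr y := fun x y h => by
      funext j
      by_cases hj : j.1 < (α : WithBot W)
      · simp [tr, hj, h j hj]
      · simp [tr, hj]
    have hc : Countable (Iio α) := hI α
    have hinf : (range fun t => tr (X t)).Infinite := by
      refine infinite_of_injective_forall_mem (f := fun m => tr (X (⟨β₀, hβ₀⟩, m, true)))
        (fun m m' h => ?_) fun m => mem_range_self _
      dsimp only at h
      have h1 : Agree α (X (⟨β₀, hβ₀⟩, m, true)) (X (⟨β₀, hβ₀⟩, m', true)) :=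
        (htr _).trans (h ▸ (htr _).symm)
      exact (hf β₀ hβ₀).e_inj _ _
        ((hX2 (⟨β₀, hβ₀⟩, m, true)).symm.trans ((h1.mono hβ₀.le).trans (hX2 (⟨β₀, hβ₀⟩, m', true))))
    have : Infinite (range fun t => tr (X t)) := hinf.to_subtype
    have : Countable (range fun t => tr (X t)) := (countable_range _).to_subtype
    obtain ⟨g⟩ := nonempty_equiv_of_countable (α := ℕ) (β := range fun t => tr (X t))
    obtain ⟨e, hei, he, hes⟩ : ∃ e : ℕ → Pt W, Function.Injective e ∧
        (∀ n, ∃ t, tr (X t) = e n) ∧ ∀ t, ∃ n, e n = tr (X t) :=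
      ⟨fun n => (g n).1, Subtype.val_injective.comp g.injective, fun n => (g n).2, fun t =>
        (g.surjective ⟨tr (X t), mem_range_self _⟩).imp fun n hn => congrArg Subtype.val hn⟩
    refine ⟨e, fun n => ?_, fun n m hnm => ?_, fun β hβ m b => ?_, fun hl n v hv hnv => ?_⟩
    · obtain ⟨t, ht⟩ := he n
      exact ht ▸ (hX1 t).congr hf (htr _)
    · obtain ⟨t, ht⟩ := he n
      obtain ⟨t', ht'⟩ := he m
      refine hei ?_
      rw [← ht, ← ht']
      rw [← ht, ← ht'] at hnm
      exact htr' _ _ ((htr _).trans (hnm.trans (htr _).symm))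
    · obtain ⟨n, hn⟩ := hes (⟨β, hβ⟩, m, b)
      refine ⟨n, ?_, ?_⟩
      · rw [hn]
        exact ((htr _).mono hβ.le).symm.trans (hX2 (⟨β, hβ⟩, m, b))
      · rw [hn, ← htr _ _ (WithBot.coe_lt_coe.2 hβ)]
        exact hX3 (⟨β, hβ⟩, m, b)
    · obtain ⟨t, ht⟩ := he n
      rw [← ht] at hnv
      exact hX4 t hl v hv ((htr _).trans hnv)
  · push Not at h0
    -- At the least α any sequence of distinct base points will do.
    refine ⟨fun k j => decide (j = (⊥, k)), fun n => ⟨fun β hβ => ?_, fun β hβ => ?_⟩,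
      fun n m h => ?_, fun β hβ => ?_, fun hl => ?_⟩
    · exact absurd hβ (h0 β).not_gt
    · exact absurd hβ (h0 β).not_gt
    · simpa using h (⊥, n) (WithBot.bot_lt_coe α)
    · exact absurd hβ (h0 β).not_gt
    · exact absurd hl.1.choose_spec (h0 _).not_gt

variable [WellFoundedLT W]

theorem exists_good (hI : ∀ α : W, (Iio α).Countable) (hG : ∀ α, IsClosed (G α))
    (hGc : ∀ α, IsCyl α (G α)) (hf : ∀ β < α, Good G β f (f β)) : ∃ d, Good G α f d := by
  have hSt : IsCyl α (Stage f α) := stage_isCyl fun β hβ => (hf β hβ).A_cyl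
  obtain ⟨D, V, hV, hDK, hDc, hD, hDV⟩ := exists_perfect_kernel hI α (Stage f α ∩ G α)
    ((stage_isClosed fun β hβ => (hf β hβ).A_closed).inter (hG α))
    (fun x y hxy hx => ⟨hSt x y hxy hx.1, hGc α x y hxy hx.2⟩)
  obtain ⟨e, he1, he2, he3, he4⟩ := exists_split_points hI hf hV
  -- The sets to be divided at `e n`: the new kernel and the preimages of all earlier kernels,
  -- whenever they contain `e n`.
  let Q : ℕ → Set (Set (Pt W)) := fun n =>
    {S | S = D ∧ e n ∈ D} ∪ {S | ∃ δ < α, e n ∈ (f δ).D ∧ S = (f δ).D ∩ Stage f α}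
  have hQc : ∀ n, (Q n).Countable := by
    intro n
    refine Countable.union ((countable_singleton D).mono fun S hS => hS.1) ?_
    refine ((hI α).image fun δ => (f δ).D ∩ Stage f α).mono ?_
    rintro S ⟨δ, hδ, -, rfl⟩
    exact ⟨δ, hδ, rfl⟩
  have hQ : ∀ n, ∀ S ∈ Q n, AccAt α S (e n) := by
    rintro n S (⟨rfl, h⟩ | ⟨δ, hδ, h, rfl⟩)
    · exact hD _ h
    · exact accAt_of_lt hf hδ ⟨h, (he1 n).1⟩
  choose A hA1 hA2 hA3 hA4 hA5 using fun n => exists_split hI α (e n) (Q n) (hQc n) (hQ n)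
  exact ⟨⟨e, A, D⟩,
    { e_mem := fun n => (he1 n).1
      e_inj := he2
      e_proj := fun β hβ n => (he1 n).2 β hβ
      e_ext := he3
      A_closed := hA1
      A_cyl := hA2
      A_cover := hA3
      A_inter := hA4
      D_cyl := hDc
      D_sub := hDK
      D_acc := hD
      scattered := fun hl x hx => (hDV x hx).imp_right fun ⟨v, hv, hxv⟩ n hxn =>
        he4 hl n v hv (hxn.symm.trans hxv)
      acc_self := fun n b hn => hA5 n _ (Or.inl ⟨rfl, hn⟩) b
      acc_lt := fun n b δ hδ hn => hA5 n _ (Or.inr ⟨δ, hδ, hn, rfl⟩) b }⟩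

theorem exists_forall_good (hI : ∀ α : W, (Iio α).Countable) (hG : ∀ α, IsClosed (G α))
    (hGc : ∀ α, IsCyl α (G α)) : ∃ f : W → StageData W, ∀ α, Good G α f (f α) :=
  exists_rec _ (fun _ _ _ _ h hd => hd.congr h) fun _ _ hf => exists_good hI hG hGc hf

/-- The limit of all stages. -/
def Limit (f : W → StageData W) : Set (Pt W) := {x | ∀ α, x ∈ Stage f α}

end Branches

/-! ### Thin sets and the limit of the construction -/

/-- A closed set of points whose projections to the countable stages have only countably many
nontrivial fibres, but at least one, and of which every closed subset `H` is captured at some stage: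
any closed subset with the same projection to that stage contains all points over it. -/
structure IsThin {W : Type v} [LinearOrder W] (X : Set (Pt W)) : Prop where
  isClosed : IsClosed X
  countable_level : ∀ α, ∃ e : ℕ → Pt W, ∀ z ∈ X, ∀ w ∈ X, Agree α z w → z ≠ w →
    ∃ n, Agree α z (e n)
  nontrivial_level : ∀ α, ∃ z ∈ X, ∃ w ∈ X, Agree α z w ∧ z ≠ w
  captured : ∀ H ⊆ X, IsClosed H → ∃ α, ∀ H' ⊆ X, IsClosed H' →
    (∀ h ∈ H, ∃ h' ∈ H', Agree α h' h) → ∀ z ∈ X, (∃ h ∈ H, Agree α z h) → z ∈ H'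

variable {W : Type v} [LinearOrder W] [WellFoundedLT W]

theorem isThin_limit [NoMaxOrder W] [Nonempty W] {G : W → Set (Pt W)} {f : W → StageData W}
    (hf : ∀ α, Good G α f (f α))
    (hG : ∀ H : Set (Pt W), IsClosed H → ∃ α, IsLim α ∧ G α = {x | ∃ h ∈ H, Agree α x h}) :
    IsThin (Limit f) := by
  have hexists : ∀ j : Idx W, ∃ α : W, j.1 < (α : WithBot W) := by
    rintro ⟨i, n⟩
    induction i with
    | bot => exact ⟨Classical.arbitrary W, WithBot.bot_lt_coe _⟩
    | coe i =>
      obtain ⟨α, hα⟩ := exists_gt i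
      exact ⟨α, WithBot.coe_lt_coe.2 hα⟩
  have huniq : ∀ α, ∀ z ∈ Limit f, ∀ w ∈ Limit f, Agree α z w →
      (∀ n, ¬ Agree α z ((f α).e n)) → z = w := by
    intro α z hz w hw hzw h
    funext j
    obtain ⟨β, hβ⟩ := hexists j
    exact agree_of_forall_not_agree (fun β _ => hf β) (hz β) (hw β) hzw h j hβ
  have hlift : ∀ α, ∀ x ∈ Stage f α, ∃ z ∈ Limit f, Agree α z x := by
    intro α x hx
    obtain ⟨z, h1, h2⟩ := exists_lift f univ (fun β _ => (hf β).A_cyl) (fun β _ => (hf β).A_cover)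
      α x hx
    exact ⟨z, fun β γ _ => h2 γ (mem_univ _), h1⟩
  refine ⟨?_, fun α => ⟨(f α).e, fun z hz w hw hzw hne => ?_⟩, fun α => ?_, fun H hHX hH => ?_⟩
  · have : Limit f = ⋂ α, Stage f α := by ext; simp [Limit]
    rw [this]
    exact isClosed_iInter fun α => stage_isClosed fun β _ => (hf β).A_closed
  · by_contra! h
    exact hne (huniq α z hz w hw hzw h)
  -- Both halves of `e 0` survive to the limit.
  · obtain ⟨β, hβ⟩ := exists_gt α
    have hpt : ∀ b, ∃ z ∈ Limit f, Agree α z ((f α).e 0) ∧ z (α, 0) = b := by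
      intro b
      obtain ⟨n, hn, hnb⟩ := (hf β).e_ext α hβ 0 b
      obtain ⟨z, hz, hzn⟩ := hlift β _ ((hf β).e_mem n)
      exact ⟨z, hz, (hzn.mono hβ.le).trans hn, by rw [hzn _ (WithBot.coe_lt_coe.2 hβ), hnb]⟩
    obtain ⟨z, hz, hz1, hz2⟩ := hpt true
    obtain ⟨w, hw, hw1, hw2⟩ := hpt false
    refine ⟨z, hz, w, hw, hz1.trans hw1.symm, fun h => ?_⟩
    rw [h, hw2] at hz2
    simp at hz2
  · obtain ⟨α, hα, hGα⟩ := hG H hH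
    refine ⟨α, fun H' hH'X hH' hHH' z hz hzH => ?_⟩
    have hzK : z ∈ Stage f α ∩ G α := ⟨hz α, hGα ▸ hzH⟩
    rcases (hf α).scattered hα z hzK with hzD | hzn
    · by_contra hzH'
      obtain ⟨F, hF⟩ := exists_finset_of_notMem hH' hzH'
      obtain ⟨β, hβ⟩ := exists_gt α
      choose i hi using hexists
      obtain ⟨γ, hβγ, hγ⟩ : ∃ γ, α < γ ∧ ∀ j ∈ F, j.1 < (γ : WithBot W) := by
        have hne : (insert β (F.image i)).Nonempty := Finset.insert_nonempty _ _
        refine ⟨(insert β (F.image i)).max' hne, hβ.trans_le (Finset.le_max' _ _ (by simp)),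
          fun j hj => (hi j).trans_le (WithBot.coe_le_coe.2 (Finset.le_max' _ _ ?_))⟩
        exact Finset.mem_insert_of_mem (Finset.mem_image_of_mem _ hj)
      -- By irreducibility a neighbourhood of `z` missing `H'` contains the whole fibre over some
      -- `x` in the kernel; but `x` lies in the guess, so a point of `H'` is over it.
      obtain ⟨x, hx, F', hF'⟩ := irred_of_lt (α := γ) (fun β _ => hf β) hβγ z ⟨hzD, hz γ⟩ F
      have hxG := ((hf α).D_sub hx).2
      rw [hGα] at hxG
      obtain ⟨h, hh, hxh⟩ := hxG
      obtain ⟨h', hh', hhh'⟩ := hHH' h hh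
      have hx' : Agree α h' x := hhh'.trans hxh.symm
      refine hF h' (fun j hj => ?_) hh'
      exact hF' h' ⟨(hf α).D_cyl _ _ hx'.symm hx, hH'X hh' γ⟩ (fun j _ hj => hx' j hj) j hj (hγ j hj)
    · obtain ⟨h, hh, hzh⟩ := hzH
      obtain ⟨h', hh', hhh'⟩ := hHH' h hh
      rw [huniq α z hz h' (hH'X hh') (hzh.trans hhh'.symm) hzn]
      exact hh'

/-! ### Guessing closed sets by ◇ -/

section Guessing

variable {W : Type v} [LinearOrder W]

theorem exists_strict_bound (hI : ∀ α : W, (Iio α).Countable) (hW : ¬ (univ : Set W).Countable)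
    {S : Set W} (hS : S.Countable) : ∃ b, ∀ x ∈ S, x < b := by
  by_contra! h
  refine hW ((hS.biUnion fun x _ => (hI x).union (countable_singleton x)).mono fun b _ => ?_)
  obtain ⟨x, hx, hb⟩ := h b
  exact mem_iUnion₂.2 ⟨x, hx, hb.lt_or_eq⟩

/-- The restriction of a point to its coordinates below `α`. -/
def res (α : W) (x : Pt W) : {j : Idx W // j.1 < (α : WithBot W)} → Bool := fun j => x j.1

theorem continuous_res (α : W) : Continuous (res α) := continuous_pi fun j => continuous_apply j.1

theorem res_eq_iff {α : W} {x y : Pt W} : res α x = res α y ↔ Agree α x y :=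
  ⟨fun h j hj => congrFun h ⟨j, hj⟩, fun h => funext fun j => h j.1 j.2⟩

theorem isClosed_image_res {H : Set (Pt W)} (hH : IsClosed H) (α : W) : IsClosed (res α '' H) :=
  (hH.isCompact.image (continuous_res α)).isClosed

theorem isClosed_saturation {H : Set (Pt W)} (hH : IsClosed H) (α : W) :
    IsClosed {x | ∃ h ∈ H, Agree α x h} := by
  have : {x | ∃ h ∈ H, Agree α x h} = res α ⁻¹' (res α '' H) := by
    ext x
    simp only [mem_ofPred_eq, mem_preimage, mem_image, res_eq_iff]
    exact exists_congr fun h => and_congr_right fun _ => ⟨Agree.symm, Agree.symm⟩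
  rw [this]
  exact (isClosed_image_res hH α).preimage (continuous_res α)

theorem countable_finset_lt (hI : ∀ α : W, (Iio α).Countable) (α : W) :
    {s : Finset (Idx W × Bool) | ∀ p ∈ s, p.1.1 < (α : WithBot W)}.Countable := by
  have h := countable_ofPred_finite_subset
    ((countable_idx_lt hI α).prod (countable_univ (α := Bool)))
  refine (h.preimage Finset.coe_injective).mono fun s hs => ?_
  exact ⟨s.finite_toSet, fun p hp => ⟨hs p hp, mem_univ _⟩⟩

/-- At these α, every basic open set with coordinates below α has its code below α, so `B ∩ Iio α`
decides all of them. At a limit a finite support is already bounded below α, which yields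
closedness; unboundedness is the usual closing off in ω steps. -/
theorem isClub_limits_closed [WellFoundedLT W] (hI : ∀ α : W, (Iio α).Countable)
    (hW : ¬ (univ : Set W).Countable) (c : Finset (Idx W × Bool) → W) :
    IsClub {α : W | IsLim α ∧ ∀ s : Finset (Idx W × Bool),
      (∀ p ∈ s, p.1.1 < (α : WithBot W)) → c s < α} := by
  classical
  have hbound : ∀ {α : W}, IsLim α → ∀ s : Finset (Idx W × Bool),
      (∀ p ∈ s, p.1.1 < (α : WithBot W)) → ∃ β < α, ∀ p ∈ s, p.1.1 < (β : WithBot W) := by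
    intro α hα s hs
    obtain ⟨β, hβ, -, h⟩ := hα.exists_finset_bound hα.1.choose_spec (s.image Prod.fst)
    exact ⟨β, hβ, fun p hp => h _ (Finset.mem_image_of_mem _ hp) (hs p hp)⟩
  constructor
  · intro d hd hne _ a ha
    by_cases had : a ∈ d
    · exact hd had
    have hcof : ∀ β < a, ∃ γ ∈ d, γ < a ∧ β < γ := by
      intro β hβ
      obtain ⟨γ, hγ, hβγ⟩ := (lt_isLUB_iff ha).1 hβ
      exact ⟨γ, hγ, lt_of_le_of_ne (ha.1 hγ) fun h => had (h ▸ hγ), hβγ⟩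
    have hlim : IsLim a := by
      obtain ⟨γ, hγ⟩ := hne
      exact ⟨⟨γ, lt_of_le_of_ne (ha.1 hγ) fun h => had (h ▸ hγ)⟩, fun β hβ =>
        (hcof β hβ).imp fun γ h => h.2⟩
    refine ⟨hlim, fun s hs => ?_⟩
    obtain ⟨β, hβ, h⟩ := hbound hlim s hs
    obtain ⟨γ, hγ, hγa, hβγ⟩ := hcof β hβ
    exact ((hd hγ).2 s fun p hp => (h p hp).trans (WithBot.coe_lt_coe.2 hβγ)).trans hγa
  · intro a
    have hg : ∀ w : W, ∃ b, w < b ∧ ∀ s : Finset (Idx W × Bool),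
        (∀ p ∈ s, p.1.1 < (w : WithBot W)) → c s < b := by
      intro w
      obtain ⟨b, hb⟩ := exists_strict_bound hI hW (((countable_finset_lt hI w).image c).insert w)
      exact ⟨b, hb w (mem_insert _ _), fun s hs => hb _ (Or.inr ⟨s, hs, rfl⟩)⟩
    choose g hg1 hg2 using hg
    let u : ℕ → W := fun n => g^[n] a
    have hu : ∀ n, u (n + 1) = g (u n) := fun n => Function.iterate_succ_apply' g n a
    obtain ⟨b₀, hb₀⟩ := exists_strict_bound hI hW (countable_range u)
    obtain ⟨b, hb, hmin⟩ := WellFounded.has_min (wellFounded_lt (α := W)) {b | ∀ n, u n < b}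
      ⟨b₀, fun n => hb₀ _ ⟨n, rfl⟩⟩
    have hcof : ∀ β < b, ∃ n, β ≤ u n := by
      intro β hβ
      by_contra! h
      exact hmin β h hβ
    have hlim : IsLim b := by
      refine ⟨⟨a, hb 0⟩, fun β hβ => ?_⟩
      obtain ⟨n, hn⟩ := hcof β hβ
      exact ⟨u (n + 1), hb _, hn.trans_lt (hu n ▸ hg1 _)⟩
    refine ⟨b, ⟨hlim, fun s hs => ?_⟩, (hb 0).le⟩
    obtain ⟨β, hβ, h⟩ := hbound hlim s hs
    obtain ⟨n, hn⟩ := hcof β hβ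
    exact (hg2 (u n) s fun p hp => (h p hp).trans_le (WithBot.coe_le_coe.2 hn)).trans
      (hu n ▸ hb (n + 1))

/-- Diamond for closed subsets of the cube. -/
theorem exists_guess [WellFoundedLT W] (hI : ∀ α : W, (Iio α).Countable)
    (hW : ¬ (univ : Set W).Countable) (c : Finset (Idx W × Bool) → W) (hc : Function.Injective c)
    (A : W → Set W) (hA : ∀ B : Set W, IsStationary {α | B ∩ Iio α = A α}) :
    ∃ G : W → Set (Pt W), (∀ α, IsClosed (G α)) ∧ (∀ α, IsCyl α (G α)) ∧
      ∀ H : Set (Pt W), IsClosed H → ∃ α, IsLim α ∧ G α = {x | ∃ h ∈ H, Agree α x h} := by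
  classical
  -- `A α` is read as a set of codes, and the guess is the complement of the basic open sets so
  -- coded with coordinates below α.
  refine ⟨fun α => {x | ∀ s : Finset (Idx W × Bool), (∀ p ∈ s, p.1.1 < (α : WithBot W)) →
    c s ∈ A α → ∃ p ∈ s, x p.1 ≠ p.2}, fun α => ?_, fun α x y hxy hx s hs hsA => ?_,
    fun H hH => ?_⟩
  · have : {x : Pt W | ∀ s : Finset (Idx W × Bool), (∀ p ∈ s, p.1.1 < (α : WithBot W)) →
        c s ∈ A α → ∃ p ∈ s, x p.1 ≠ p.2} = ⋂ (s : Finset (Idx W × Bool))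
        (_ : ∀ p ∈ s, p.1.1 < (α : WithBot W)) (_ : c s ∈ A α),
        (⋂ p ∈ s, {x : Pt W | x p.1 = p.2})ᶜ := by
      ext x
      simp
    simp only [this]
    exact isClosed_iInter fun s => isClosed_iInter fun _ => isClosed_iInter fun _ =>
      (isOpen_biInter_finset fun p _ => isOpen_coord p.1 p.2).isClosed_compl
  · obtain ⟨p, hp, hne⟩ := hx s hs hsA
    exact ⟨p, hp, hxy p.1 (hs p hp) ▸ hne⟩
  -- The set offered to ◇ consists of the codes of the basic open sets disjoint from `H`.
  · let B : Set W := {w | ∃ s, c s = w ∧ ∀ h ∈ H, ∃ p ∈ s, h p.1 ≠ p.2}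
    obtain ⟨α, hα, hlim, hcα⟩ := hA B (isClub_limits_closed hI hW c)
    have hB : B ∩ Iio α = A α := hα
    refine ⟨α, hlim, Subset.antisymm (fun x hx => ?_) ?_⟩
    · by_contra hxS
      have hcyl : IsCyl α {x | ∃ h ∈ H, Agree α x h} :=
        fun x y hxy ⟨h, hh, hxh⟩ => ⟨h, hh, hxy.symm.trans hxh⟩
      obtain ⟨F, hF⟩ := hcyl.exists_finset_of_notMem (isClosed_saturation hH α) hxS
      let s : Finset (Idx W × Bool) :=
        (F.filter fun j => j.1 < (α : WithBot W)).image fun j => (j, x j)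
      have hs : ∀ p ∈ s, p.1.1 < (α : WithBot W) := by
        intro p hp
        obtain ⟨j, hj, rfl⟩ := Finset.mem_image.1 hp
        exact (Finset.mem_filter.1 hj).2
      have hsA : c s ∈ A α := by
        rw [← hB]
        refine ⟨⟨s, rfl, fun h hh => ?_⟩, hcα s hs⟩
        by_contra! hp
        exact hF h (fun j hj hjα => hp (j, x j)
          (Finset.mem_image.2 ⟨j, Finset.mem_filter.2 ⟨hj, hjα⟩, rfl⟩)) ⟨h, hh, Agree.refl _ _⟩
      obtain ⟨p, hp, hne⟩ := hx s hs hsA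
      obtain ⟨j, _, rfl⟩ := Finset.mem_image.1 hp
      exact hne rfl
    · rintro x ⟨h, hh, hxh⟩ s hs hsA
      rw [← hB] at hsA
      obtain ⟨t, hts, ht⟩ := hsA.1
      obtain rfl := hc hts
      obtain ⟨p, hp, hne⟩ := ht h hh
      exact ⟨p, hp, (hxh p.1 (hs p hp)).symm ▸ hne⟩

end Guessing

/-! ### Topological properties of thin sets -/

section Thin

variable {W : Type v} [LinearOrder W] {X : Type u} [TopologicalSpace X] {ψ : X → Pt W}

theorem IsThin.isClosedEmbedding (hX : IsThin (range ψ)) (hψ : IsEmbedding ψ) :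
    IsClosedEmbedding ψ := ⟨hψ, hX.isClosed⟩

theorem IsThin.compactSpace (hX : IsThin (range ψ)) (hψ : IsEmbedding ψ) : CompactSpace X :=
  (hX.isClosedEmbedding hψ).compactSpace

/-- A closed set is determined, in a strong sense, by its projection to a countable stage. -/
theorem IsThin.exists_captured (hX : IsThin (range ψ)) (hψ : IsEmbedding ψ) {H : Set X}
    (hH : IsClosed H) : ∃ α : W, ∀ H' : Set X, IsClosed H' →
      (∀ h ∈ H, ∃ h' ∈ H', Agree α (ψ h') (ψ h)) → ∀ z, (∃ h ∈ H, Agree α (ψ z) (ψ h)) →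
        z ∈ H' := by
  have hψc := hX.isClosedEmbedding hψ
  obtain ⟨α, hα⟩ := hX.captured (ψ '' H) (image_subset_range _ _) (hψc.isClosedMap _ hH)
  refine ⟨α, fun H' hH' hHH' z ⟨h, hh, hzh⟩ => ?_⟩
  have := hα (ψ '' H') (image_subset_range _ _) (hψc.isClosedMap _ hH') (by
    rintro _ ⟨h, hh, rfl⟩
    obtain ⟨h', hh', hag⟩ := hHH' h hh
    exact ⟨_, ⟨h', hh', rfl⟩, hag⟩) (ψ z) (mem_range_self z) ⟨_, ⟨h, hh, rfl⟩, hzh⟩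
  rwa [hψ.injective.mem_set_image] at this

/-- A captured closed set is the full preimage of its projection to a metrizable stage. Its
complement is thus the preimage of an F_σ set, hence σ-compact. -/
theorem IsThin.hereditarilyLindelof (hI : ∀ α : W, (Iio α).Countable) (hX : IsThin (range ψ))
    (hψ : IsEmbedding ψ) : HereditarilyLindelofSpace X := by
  have := hX.compactSpace hψ
  refine HereditarilyLindelofSpace.of_forall_isOpen fun U hU => ?_
  obtain ⟨α, hα⟩ := hX.exists_captured hψ hU.isClosed_compl
  let J := {j : Idx W // j.1 < (α : WithBot W)}
  have : Countable J := countable_idx_lt hI α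
  let _ : MetricSpace (J → Bool) := metrizableSpaceMetric _
  have hc : Continuous (res α ∘ ψ) := (continuous_res α).comp hψ.continuous
  have hK : IsClosed (res α ∘ ψ '' Uᶜ) := (hU.isClosed_compl.isCompact.image hc).isClosed
  obtain ⟨F, hF, -, hFU, -⟩ := hK.isOpen_compl.exists_iUnion_isClosed
  have hUF : U = ⋃ n, res α ∘ ψ ⁻¹' F n := by
    rw [← preimage_iUnion, hFU]
    ext z
    simp only [mem_preimage, mem_compl_iff, mem_image, not_exists, not_and]
    constructor
    · intro hz h hh hhz
      exact hα Uᶜ hU.isClosed_compl (fun h hh => ⟨h, hh, Agree.refl _ _⟩) z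
        ⟨h, hh, (res_eq_iff.1 hhz).symm⟩ hz
    · intro h
      by_contra hz
      exact h z hz rfl
  rw [hUF]
  exact isLindelof_iUnion fun n => ((hF n).preimage hc).isCompact.isLindelof

/-- For the α capturing the closure of `S`, lift to `S` a countable dense set of its projection. By
compactness the closure of the lift projects onto that of `S`, so it contains `S`. -/
theorem IsThin.hereditarilySeparable (hI : ∀ α : W, (Iio α).Countable) (hX : IsThin (range ψ))
    (hψ : IsEmbedding ψ) : HereditarilySeparable X := by
  intro S
  have := hX.compactSpace hψ
  obtain ⟨α, hα⟩ := hX.exists_captured hψ (isClosed_closure (s := S))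
  let J := {j : Idx W // j.1 < (α : WithBot W)}
  have : Countable J := countable_idx_lt hI α
  have hc : Continuous (res α ∘ ψ) := (continuous_res α).comp hψ.continuous
  obtain ⟨D₀, hD₀c, hD₀⟩ := exists_countable_dense (res α ∘ ψ '' S)
  choose g hgS hg using fun y : (res α ∘ ψ '' S) => y.2
  let D : Set S := (fun y => ⟨g y, hgS y⟩) '' D₀
  have hDD₀ : res α ∘ ψ '' (Subtype.val '' D) = Subtype.val '' D₀ := by
    rw [image_image, image_image]
    exact image_congr fun y _ => hg y
  refine ⟨⟨D, hD₀c.image _, Subtype.dense_iff.2 fun z hz => ?_⟩⟩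
  refine hα _ isClosed_closure (fun h hh => ?_) z ⟨z, subset_closure hz, Agree.refl _ _⟩
  have h1 : res α (ψ h) ∈ closure (res α ∘ ψ '' S) :=
    image_closure_subset_closure_image hc ⟨h, hh, rfl⟩
  have h2 : closure (res α ∘ ψ '' S) ⊆ closure (res α ∘ ψ '' (Subtype.val '' D)) := by
    rw [hDD₀]
    exact closure_minimal (Subtype.dense_iff.1 hD₀) isClosed_closure
  have h3 : closure (res α ∘ ψ '' (Subtype.val '' D)) ⊆
      res α ∘ ψ '' closure (Subtype.val '' D) :=
    closure_minimal (image_mono subset_closure) (isClosed_closure.isCompact.image hc).isClosed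
  obtain ⟨h', hh', hag⟩ := h3 (h2 h1)
  exact ⟨h', hh', res_eq_iff.1 hag⟩

theorem isTopologicalBasis_pt : IsTopologicalBasis
    (range fun s : Finset (Idx W × Bool) => {y : Pt W | ∀ p ∈ s, y p.1 = p.2}) := by
  classical
  refine isTopologicalBasis_of_isOpen_of_nhds ?_ fun x U hx hU => ?_
  · rintro _ ⟨s, rfl⟩
    have : {y : Pt W | ∀ p ∈ s, y p.1 = p.2} = ⋂ p ∈ s, {y : Pt W | y p.1 = p.2} := by
      ext
      simp
    simp only [this]
    exact isOpen_biInter_finset fun p _ => isOpen_coord p.1 p.2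
  · obtain ⟨F, hF⟩ := exists_finset_of_notMem hU.isClosed_compl (not_not.2 hx)
    refine ⟨_, ⟨F.image fun j => (j, x j), rfl⟩, fun p hp => ?_, fun y hy => ?_⟩
    · obtain ⟨j, _, rfl⟩ := Finset.mem_image.1 hp
      rfl
    · exact not_not.1 (hF y fun j hj => hy (j, x j) (Finset.mem_image_of_mem _ hj))

/-- Capturing `{x}` makes `x` the only point agreeing with it below some α. By compactness the
finite conditions on those countably many coordinates form a local base. -/
theorem IsThin.character_eq (hI : ∀ α : W, (Iio α).Countable) (hX : IsThin (range ψ))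
    (hψ : IsEmbedding ψ) : character X = ℵ₀ := by
  have := hX.compactSpace hψ
  refine max_eq_left (ciSup_le' fun x => ?_)
  have := hψ.t2Space
  obtain ⟨α, hα⟩ := hX.exists_captured hψ (isClosed_singleton (x := x))
  let J := {j : Idx W // j.1 < (α : WithBot W)}
  have : Countable J := countable_idx_lt hI α
  let N : Finset J → Set X := fun F => {y | ∀ j ∈ F, ψ y j.1 = ψ x j.1}
  have hclopen : ∀ j : J, IsClosed {y | ψ y j.1 = ψ x j.1} ∧ IsOpen {y | ψ y j.1 = ψ x j.1} :=
    fun j => ⟨(isClosed_coord j.1 (ψ x j.1)).preimage hψ.continuous,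
      (isOpen_coord j.1 (ψ x j.1)).preimage hψ.continuous⟩
  have hN : ∀ F, N F = ⋂ j ∈ F, {y | ψ y j.1 = ψ x j.1} := fun F => by
    ext
    simp [N]
  suffices h : IsLocalBase x (range N) from
    (csInf_le' (show #(range N) ∈ {κ | ∃ B : Set (Set X), IsLocalBase x B ∧ #B = κ} from
      ⟨_, h, rfl⟩)).trans (Cardinal.le_aleph0_iff_set_countable.2 (countable_range N))
  refine ⟨?_, fun U hU hx => ?_⟩
  · rintro _ ⟨F, rfl⟩
    refine ⟨?_, fun j _ => rfl⟩
    rw [hN]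
    exact isOpen_biInter_finset fun j _ => (hclopen j).2
  · obtain ⟨F, hF⟩ := hU.isClosed_compl.isCompact.elim_finite_subfamily_closed
      (fun j : J => {y | ψ y j.1 = ψ x j.1}) (fun j => (hclopen j).1) (by
        rw [eq_empty_iff_forall_notMem]
        rintro y ⟨hyU, hy⟩
        have hag : Agree α (ψ y) (ψ x) := fun j hj => mem_iInter.1 hy ⟨j, hj⟩
        have : y ∈ ({x} : Set X) := hα {x} isClosed_singleton
          (fun h hh => ⟨h, hh, Agree.refl _ _⟩) y ⟨x, rfl, hag⟩
        rw [mem_singleton_iff.1 this] at hyU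
        exact hyU hx)
    refine ⟨_, ⟨F, rfl⟩, fun y hy => ?_⟩
    by_contra hyU
    rw [← hN] at hF
    exact eq_empty_iff_forall_notMem.1 hF y ⟨hyU, hy⟩

/-- A countable base could be taken among the standard basic sets. Their coordinates are bounded by
some α, so they cannot separate two distinct points agreeing below α. -/
theorem IsThin.not_secondCountable (hI : ∀ α : W, (Iio α).Countable)
    (hW : ¬ (univ : Set W).Countable) (hX : IsThin (range ψ)) (hψ : IsEmbedding ψ) :
    ¬ SecondCountableTopology X := by
  classical
  intro hsc
  have hb := isTopologicalBasis_pt (W := W).induced ψ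
  rw [← hψ.eq_induced, ← range_comp] at hb
  obtain ⟨t, htb, htc, ht⟩ := hb.exists_countable
  have htb' : ∀ U ∈ t, ∃ s : Finset (Idx W × Bool), ψ ⁻¹' {y | ∀ p ∈ s, y p.1 = p.2} = U :=
    fun U hU => htb hU
  choose! s hs using htb'
  have hcount : (⋃ U ∈ t, ((s U).image fun p => p.1 : Set (Idx W))).Countable :=
    htc.biUnion fun U _ => Finset.countable_toSet _
  obtain ⟨α, hα⟩ : ∃ α : W, ∀ j ∈ ⋃ U ∈ t, ((s U).image fun p => p.1 : Set (Idx W)),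
      j.1 < (α : WithBot W) := by
    obtain ⟨b, hb⟩ := exists_strict_bound hI hW
      ((hcount.image Prod.fst).preimage (WithBot.coe_injective (α := W)))
    refine ⟨b, ?_⟩
    rintro ⟨i, n⟩ hj
    induction i with
    | bot => exact WithBot.bot_lt_coe b
    | coe i => exact WithBot.coe_lt_coe.2 (hb i ⟨_, hj, rfl⟩)
  obtain ⟨_, ⟨z, rfl⟩, _, ⟨w, rfl⟩, hag, hne⟩ := hX.nontrivial_level α
  have := hψ.t2Space
  have hzw : z ≠ w := fun h => hne (h ▸ rfl)
  obtain ⟨U, hU, hzU, hwU⟩ := ht.mem_nhds_iff.1 (isOpen_compl_singleton.mem_nhds hzw)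
  refine hwU (?_ : w ∈ U) rfl
  rw [← hs U hU] at hzU ⊢
  intro p hp
  rw [← hag p.1 (hα _ (mem_iUnion₂.2 ⟨U, hU, Finset.mem_coe.2 (Finset.mem_image_of_mem _ hp)⟩))]
  exact hzU p hp

theorem IsThin.weight_eq (hI : ∀ α : W, (Iio α).Countable)
    (hW : ¬ (univ : Set W).Countable) (hc : #(Finset (Idx W × Bool)) ≤ ℵ₁)
    (hX : IsThin (range ψ)) (hψ : IsEmbedding ψ) : weight X = ℵ₁ := by
  have hb := isTopologicalBasis_pt (W := W).induced ψ
  rw [← hψ.eq_induced, ← range_comp] at hb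
  have hmem : _ ∈ {κ | ∃ B : Set (Set X), IsTopologicalBasis B ∧ #B = κ} := ⟨_, hb, rfl⟩
  refine le_antisymm (max_le Cardinal.aleph0_lt_aleph_one.le ((csInf_le' hmem).trans ?_))
    (le_max_of_le_right (le_csInf ⟨_, hmem⟩ ?_))
  · have h1 := Cardinal.mk_range_le_lift
      (f := preimage ψ ∘ fun s : Finset (Idx W × Bool) => {y : Pt W | ∀ p ∈ s, y p.1 = p.2})
    have h2 := h1.trans (Cardinal.lift_le.2 hc)
    simpa using h2
  · rintro _ ⟨B, hB, rfl⟩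
    rw [← Cardinal.succ_aleph0, Order.succ_le_iff, ← not_le, Cardinal.le_aleph0_iff_set_countable]
    exact fun h => hX.not_secondCountable hI hW hψ (hB.secondCountableTopology h)

end Thin

/-! ### Transfer to `[0,1]^{ω₁}` -/

section Embedding

/-- The ordinals below `ω₁`. -/
abbrev Om : Type 1 := Iio (ω₁ : Ordinal.{0})

theorem countable_Iio_om (α : Om) : (Iio α).Countable := by
  have h : (Iio α.1).Countable := by
    rw [← Cardinal.le_aleph0_iff_set_countable, Cardinal.mk_Iio_ordinal, Cardinal.lift_le_aleph0,
      ← Order.lt_succ_iff, Cardinal.succ_aleph0, ← Cardinal.lt_ord, Cardinal.ord_aleph]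
    exact α.2
  exact h.preimage Subtype.val_injective

theorem mk_om : #Om = ℵ₁ := by
  rw [Cardinal.mk_Iio_ordinal, Ordinal.card_omega]
  simp

theorem not_countable_om : ¬ (univ : Set Om).Countable := by
  rw [← Cardinal.le_aleph0_iff_set_countable, Cardinal.mk_univ, mk_om, not_le]
  exact Cardinal.aleph0_lt_aleph_one

theorem mk_finset_om : #(Finset (Idx Om × Bool)) = ℵ₁ := by
  have h : #(WithBot Om) = ℵ₁ := by
    have := Cardinal.mk_option (α := Om)
    rw [mk_om, Cardinal.add_one_eq Cardinal.aleph0_lt_aleph_one.le] at this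
    exact this
  have h2 : #(Idx Om × Bool) = ℵ₁ := by
    rw [Cardinal.mk_prod, Cardinal.mk_prod, h]
    simpa using Cardinal.mul_eq_left (Cardinal.aleph0_le_aleph 1)
      ((Cardinal.natCast_lt_aleph0 (n := 2)).le.trans (Cardinal.aleph0_le_aleph 1)) two_ne_zero
  have : Infinite (Idx Om × Bool) := by
    rw [Cardinal.infinite_iff, h2]
    exact Cardinal.aleph0_lt_aleph_one.le
  rw [Cardinal.mk_finset_of_infinite, h2]

/-- The base coordinates and those belonging to `ξ` are coded by one number in `[0,1]`. -/
noncomputable def toCube (x : Pt Om) : Cube ω₁ := fun ξ =>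
  inclusion cantorSet_subset_unitInterval (cantorSetHomeomorphNatToBool.symm
    (cantorSpaceHomeomorphNatToCantorSpace.symm
      fun n m => if n = 0 then x (⊥, m) else x (((ξ : Om) : WithBot Om), m)))

theorem continuous_toCube : Continuous toCube := by
  refine continuous_pi fun ξ => (continuous_inclusion cantorSet_subset_unitInterval).comp
    ((Homeomorph.continuous _).comp ((Homeomorph.continuous _).comp
      (continuous_pi fun n => continuous_pi fun m => ?_)))
  split_ifs
  exacts [continuous_apply _, continuous_apply _]

theorem toCube_apply_eq_iff {x y : Pt Om} {ξ : Om} : toCube x ξ = toCube y ξ ↔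
    ∀ m, x (⊥, m) = y (⊥, m) ∧ x ((ξ : WithBot Om), m) = y ((ξ : WithBot Om), m) := by
  unfold toCube
  rw [(inclusion_injective _).eq_iff, EmbeddingLike.apply_eq_iff_eq, EmbeddingLike.apply_eq_iff_eq]
  constructor
  · intro h m
    exact ⟨by simpa using congrFun (congrFun h 0) m, by simpa using congrFun (congrFun h 1) m⟩
  · intro h
    funext n m
    split_ifs
    exacts [(h m).1, (h m).2]

/-- The base coordinates are repeated in every coordinate of the cube. Only the projection to
`[0,1]^0` loses them, so α must not be least; the club used below omits just that ordinal. -/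
theorem proj_toCube_eq_iff {x y : Pt Om} {α : Om} (hα : ∃ β, β < α) :
    proj (le_of_lt α.2) (toCube x) = proj (le_of_lt α.2) (toCube y) ↔ Agree α x y := by
  have key : proj (le_of_lt α.2) (toCube x) = proj (le_of_lt α.2) (toCube y) ↔
      ∀ ξ < α, toCube x ξ = toCube y ξ := by
    refine ⟨fun h ξ hξ => congrFun h ⟨ξ.1, hξ⟩, fun h => funext fun ξ => ?_⟩
    exact h ⟨ξ.1, lt_trans (mem_Iio.1 ξ.2) (mem_Iio.1 α.2)⟩ ξ.2
  simp only [key, toCube_apply_eq_iff]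
  constructor
  · rintro h ⟨i, n⟩ hi
    induction i with
    | bot => exact (h _ hα.choose_spec n).1
    | coe i => exact (h i (WithBot.coe_lt_coe.1 hi) n).2
  · exact fun h ξ hξ m => ⟨h _ (WithBot.bot_lt_coe α), h _ (WithBot.coe_lt_coe.2 hξ)⟩

theorem injective_toCube : Function.Injective toCube := by
  intro x y h
  funext ⟨i, n⟩
  have h' := fun ξ : Om => toCube_apply_eq_iff.1 (congrFun h ξ)
  induction i with
  | bot => exact (h' ⟨0, Ordinal.omega_pos 1⟩ n).1
  | coe i => exact (h' i n).2

theorem isEmbeddedAronszajnCompactum_image {X : Set (Pt Om)} (hX : IsThin X) :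
    IsEmbeddedAronszajnCompactum (toCube '' X) := by
  have hemb : IsClosedEmbedding toCube := continuous_toCube.isClosedEmbedding injective_toCube
  let ψ : (toCube '' X) → Pt Om := fun z => ((hemb.isEmbedding.homeomorphImage X).symm z).1
  have hψ : IsEmbedding ψ :=
    IsEmbedding.subtypeVal.comp (hemb.isEmbedding.homeomorphImage X).symm.isEmbedding
  have hr : range ψ = X := by
    have : ψ = Subtype.val ∘ (hemb.isEmbedding.homeomorphImage X).symm := rfl
    rw [this, (hemb.isEmbedding.homeomorphImage X).symm.surjective.range_comp, Subtype.range_coe]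
  have hX' : IsThin (range ψ) := hr.symm ▸ hX
  refine ⟨hemb.isClosedMap _ hX.isClosed,
    hX'.weight_eq countable_Iio_om not_countable_om mk_finset_om.le hψ,
    hX'.character_eq countable_Iio_om hψ, {α | ∃ β, β < α}, ⟨?_, ?_⟩, fun α hα => ?_⟩
  · rintro d hd ⟨α, hα⟩ - a ha
    obtain ⟨β, hβ⟩ := hd hα
    exact ⟨β, hβ.trans_le (ha.1 hα)⟩
  · intro α
    obtain ⟨b, hb⟩ := exists_strict_bound countable_Iio_om not_countable_om (countable_singleton α)
    exact ⟨b, ⟨α, hb α rfl⟩, (hb α rfl).le⟩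
  · obtain ⟨e, he⟩ := hX.countable_level α
    refine (countable_range fun n => proj (le_of_lt α.2) (toCube (e n))).mono ?_
    rintro x ⟨-, _, ⟨⟨z, hz, rfl⟩, hzx⟩, _, ⟨⟨w, hw, rfl⟩, hwx⟩, hne⟩
    obtain ⟨n, hn⟩ := he z hz w hw ((proj_toCube_eq_iff hα).1 (hzx.trans hwx.symm))
      fun h => hne (h ▸ rfl)
    exact ⟨n, ((proj_toCube_eq_iff hα).2 hn).symm.trans hzx⟩

theorem exists_isThin (h : Diamond) : ∃ X : Set (Pt Om), IsThin X := by
  obtain ⟨A, -, hA⟩ := h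
  obtain ⟨c⟩ : Nonempty (Finset (Idx Om × Bool) ↪ Om) := by
    rw [← Cardinal.le_def, mk_finset_om, mk_om]
  obtain ⟨G, hG, hGc, hGH⟩ :=
    exists_guess countable_Iio_om not_countable_om c c.injective A hA
  obtain ⟨f, hf⟩ := exists_forall_good countable_Iio_om hG hGc
  have : Nonempty Om := ⟨⟨0, Ordinal.omega_pos 1⟩⟩
  have : NoMaxOrder Om := ⟨fun α => (exists_strict_bound countable_Iio_om not_countable_om
    (countable_singleton α)).imp fun b hb => hb α rfl⟩
  exact ⟨_, isThin_limit hf hGH⟩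

/-- `Om` lives in `Type 1`; smallness allows the compactum to be moved to `Type`. -/
instance : Small.{0} (Idx Om) := by
  have : Small.{0} (WithBot Om) := by
    refine small_of_surjective (α := Om ⊕ Unit) (f := Sum.elim (↑) fun _ => ⊥) fun i => ?_
    induction i with
    | bot => exact ⟨Sum.inr (), rfl⟩
    | coe i => exact ⟨Sum.inl i, rfl⟩
  exact small_prod ..

end Embedding

end Aronszajn

theorem mainTheorem1 (h_diamond : Aronszajn.Diamond) :
    ∃ (X : Type) (_ : TopologicalSpace X),
      Aronszajn.IsAronszajnCompactum X ∧ Aronszajn.HereditarilySeparable X ∧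
        HereditarilyLindelofSpace X := by
  open Aronszajn in
  obtain ⟨X, hX⟩ := exists_isThin h_diamond
  let φ := (Shrink.homeomorph.{0} X).symm
  have hψ : IsEmbedding (Subtype.val ∘ φ) := IsEmbedding.subtypeVal.comp φ.isEmbedding
  have hr : range (Subtype.val ∘ φ) = X := by
    rw [φ.surjective.range_comp, Subtype.range_coe]
  have hX' : IsThin (range (Subtype.val ∘ φ)) := hr.symm ▸ hX
  have hemb : IsClosedEmbedding toCube := continuous_toCube.isClosedEmbedding injective_toCube
  exact ⟨Shrink.{0} X, inferInstance,
    { t2 := hψ.t2Space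
      compact := hX'.compactSpace hψ
      weight_eq := hX'.weight_eq countable_Iio_om not_countable_om mk_finset_om.le hψ
      character_eq := hX'.character_eq countable_Iio_om hψ
      exists_embedded := ⟨_, isEmbeddedAronszajnCompactum_image hX,
        ⟨φ.trans (hemb.isEmbedding.homeomorphImage X)⟩⟩ },
    hX'.hereditarilySeparable countable_Iio_om hψ, hX'.hereditarilyLindelof countable_Iio_om hψ⟩
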